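/- Let $I(x,y,z)=x^2+y^2+z^2-2xyz-1$ be the Fricke--Vogt invariant and let $$\mathcal G=\{F\in\mathbb Z[x,y,z]^3 \mid I(F(x,y,z))=I(x,y,z)\ \text{and}\ F(1,1,1)=(1,1,1)\}$$ be the set of Nielsen trace maps, with composition of polynomial mappings as multiplication. Then $\mathcal G$ is a group isomorphic to $PGl(2,\mathbb Z)=Gl(2,\mathbb Z)/\{\pm 1\}$. For $F\in\mathcal G$, let $\mathcal S_{\mathcal G}(F)=\{S\in\mathcal G\mid S \text{ invertible in } \mathcal G,\ S\circ F=F\circ S\}$ be its symmetry group within $\mathcal G$. Then, for every $F\in\mathcal G$: (1) $\mathcal S_{\mathcal G}(F)=\mathcal G$ if and only if $F=\mathrm{Id}$; (2) $\mathcal S_{\mathcal G}(F)\simeq C_2\times C_2$ if and only if $F^2=\mathrm{Id}\neq F$; (3) $\mathcal S_{\mathcal G}(F)\simeq C_3$ if and only if $F^3=\mathrm{Id}\neq F$; (4) $\mathcal S_{\mathcal G}(F)\simeq C_\infty$ (the infinite cyclic group) if and only if $F$ is not of finite order. Moreover, these four cases exhaust all $F\in\mathcal G$: an $F\in\mathcal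 G$ of finite order has order $1$, $2$ or $3$. -/

import Mathlib

/-- A polynomial mapping of `3`-space with integer coefficients: an element of `ℤ[x, y, z]³`,
given by its three coordinate polynomials in the variables `x = X 0`, `y = X 1`, `z = X 2`. -/
@[ext]
structure PolyMap where
  /-- The coordinate polynomials. -/
  coord : Fin 3 → MvPolynomial (Fin 3) ℤ

namespace PolyMap

open MvPolynomial

/-- Polynomial mappings form a monoid under composition: `F * G` is `F ∘ G`, obtained by
substituting the coordinates of `G` for the variables in the coordinates of `F`. -/
noncomputable instance : Monoid PolyMap where
  mul F G := ⟨fun i => bind₁ G.coord (F.coord i)⟩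
  one := ⟨fun i => X i⟩
  mul_assoc F G H := by
    ext1
    funext i
    exact bind₁_bind₁ G.coord H.coord (F.coord i)
  one_mul F := by
    ext1
    funext i
    exact bind₁_X_right F.coord i
  mul_one F := by
    ext1
    funext i
    exact DFunLike.congr_fun bind₁_X_left (F.coord i)

/-- The image `F(p)` of an integer point `p` under a polynomial mapping `F`. -/
noncomputable def evalAt (F : PolyMap) (p : Fin 3 → ℤ) : Fin 3 → ℤ :=
  fun i => MvPolynomial.eval p (F.coord i)

theorem mul_coord (F G : PolyMap) (i : Fin 3) :
    (F * G).coord i = bind₁ G.coord (F.coord i) := rfl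

theorem one_coord (i : Fin 3) : (1 : PolyMap).coord i = X i := rfl

theorem evalAt_mul (F G : PolyMap) (p : Fin 3 → ℤ) :
    (F * G).evalAt p = F.evalAt (G.evalAt p) := by
  funext i
  simp only [evalAt, mul_coord]
  exact eval₂Hom_bind₁ (RingHom.id ℤ) p G.coord (F.coord i)

theorem evalAt_one (p : Fin 3 → ℤ) : (1 : PolyMap).evalAt p = p := by
  funext i
  simp [evalAt, one_coord]

end PolyMap

/-- The Fricke-Vogt invariant `I(x, y, z) = x² + y² + z² - 2 x y z - 1`. -/
noncomputable def frickeVogt : MvPolynomial (Fin 3) ℤ :=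
  MvPolynomial.X 0 ^ 2 + MvPolynomial.X 1 ^ 2 + MvPolynomial.X 2 ^ 2
    - 2 * MvPolynomial.X 0 * MvPolynomial.X 1 * MvPolynomial.X 2 - 1

/-- The set `𝒢` of Nielsen trace maps: the polynomial mappings `F` with integer coefficients
such that `I(F(x, y, z)) = I(x, y, z)` and `F(1, 1, 1) = (1, 1, 1)`, with composition as
multiplication. No invertibility is imposed: a priori this is only a monoid. -/
noncomputable def nielsenTraceMaps : Submonoid PolyMap where
  carrier := {F | MvPolynomial.bind₁ F.coord frickeVogt = frickeVogt ∧
    F.evalAt (fun _ => 1) = fun _ => 1}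
  mul_mem' := by
    rintro F G ⟨hF, hF'⟩ ⟨hG, hG'⟩
    refine ⟨?_, ?_⟩
    · have h := MvPolynomial.bind₁_bind₁ F.coord G.coord frickeVogt
      rw [hF, hG] at h
      exact h.symm
    · rw [PolyMap.evalAt_mul, hG', hF']
  one_mem' := ⟨DFunLike.congr_fun MvPolynomial.bind₁_X_left frickeVogt,
    PolyMap.evalAt_one _⟩

/-- The symmetry group `𝒮_𝒢(F)`: all invertible `S ∈ 𝒢` with `S ∘ F = F ∘ S`. -/
def symmetryGroup (F : nielsenTraceMaps) : Submonoid nielsenTraceMaps where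
  carrier := {S | IsUnit S ∧ S * F = F * S}
  mul_mem' := by
    rintro S T ⟨hS, hS'⟩ ⟨hT, hT'⟩
    exact ⟨hS.mul hT, Commute.mul_left (show Commute S F from hS') hT'⟩
  one_mem' := ⟨isUnit_one, Commute.one_left F⟩

/-- The symmetry group is closed under inverses. -/
theorem symmetryGroup_inv (F : nielsenTraceMaps) (S : nielsenTraceMapsˣ)
    (hS : (S : nielsenTraceMaps) ∈ symmetryGroup F) :
    ((S⁻¹ : nielsenTraceMapsˣ) : nielsenTraceMaps) ∈ symmetryGroup F :=
  ⟨S⁻¹.isUnit, Commute.units_inv_left (show Commute (S : nielsenTraceMaps) F from hS.2)⟩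

/-! The proof identifies `𝒢` with `PGL(2, ℤ)` and then classifies centralizers there.

Generation. The coordinates of a Nielsen trace map solve `f² + g² + h² - 2fgh = I + 1`, whose right
side has leading monomial `xyz`. As for the Markov equation, replacing the coordinate of largest
degree by twice the product of the others minus itself lowers its degree, unless the three degrees
already add up to that of `xyz` (`degree_descent`). In that case the map is affine, hence a
permutation of the coordinates. So `𝒢` is generated by reflections and permutations, and all its
elements are invertible.

Isomorphism. The surface `I = 0` is singular at `(1, 1, 1)`, with tangent cone parametrized by `(u²,
v², (u + v)²)`. The generators, hence all of `𝒢`, act on this cone through matrices in `GL(2, ℤ)`,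
well defined up to sign; dual numbers express this algebraically. The action is faithful because
labels grow along reduced words (`hexLabel_lt`), and every matrix occurs because `S` and `T`
generate `SL(2, ℤ)`.

Centralizers. Let `D = t² - 4 det` be the discriminant of a matrix of trace `t`. If `|D| > 4`, then
`D` is positive and not a square; the centralizer consists of units of a real quadratic order, and
the logarithm embeds it modulo `±1` discretely in `ℝ`. If `|D| ≤ 4`, reduction of the associated
quadratic form leaves, up to conjugation and sign, the identity, parabolic matrices, three
involutions and the elements of order three, each treated by hand. -/

open MvPolynomial in
theorem bind₁_frickeVogt (c : Fin 3 → MvPolynomial (Fin 3) ℤ) :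
    bind₁ c frickeVogt = c 0 ^ 2 + c 1 ^ 2 + c 2 ^ 2 - 2 * c 0 * c 1 * c 2 - 1 := by
  have h2 : bind₁ c (2 : MvPolynomial (Fin 3) ℤ) = 2 := map_ofNat _ 2
  simp [frickeVogt, h2]

/-! ### Generators: permutations, reflections and reduced words -/

namespace PolyMap

open MvPolynomial

/-- The permutation of coordinates by `σ`. -/
noncomputable def perm (σ : Equiv.Perm (Fin 3)) : PolyMap := ⟨fun i => X (σ i)⟩

/-- The reflection replacing the coordinate `k` by twice the product of the other two minus the
coordinate `k`. -/
noncomputable def reflection (k : Fin 3) : PolyMap :=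
  ⟨Function.update X k (2 * X (k + 1) * X (k + 2) - X k)⟩

theorem perm_mul_coord (σ : Equiv.Perm (Fin 3)) (F : PolyMap) (i : Fin 3) :
    (perm σ * F).coord i = F.coord (σ i) := by
  simp [mul_coord, perm]

theorem reflection_mul_coord_self (k : Fin 3) (F : PolyMap) :
    (reflection k * F).coord k = 2 * F.coord (k + 1) * F.coord (k + 2) - F.coord k := by
  have h2 : bind₁ F.coord (2 : MvPolynomial (Fin 3) ℤ) = 2 := map_ofNat _ 2
  simp [mul_coord, reflection, h2]

theorem reflection_mul_coord_of_ne {k i : Fin 3} (h : i ≠ k) (F : PolyMap) :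
    (reflection k * F).coord i = F.coord i := by
  simp [mul_coord, reflection, Function.update_of_ne h]

theorem reflection_mul_reflection_mul (k : Fin 3) (F : PolyMap) :
    reflection k * (reflection k * F) = F := by
  ext1
  funext i
  by_cases h : i = k
  · subst h
    rw [reflection_mul_coord_self, reflection_mul_coord_self,
      reflection_mul_coord_of_ne (by simp), reflection_mul_coord_of_ne (by simp)]
    ring
  · rw [reflection_mul_coord_of_ne h, reflection_mul_coord_of_ne h]

theorem reflection_mul_self (k : Fin 3) : reflection k * reflection k = 1 := by
  simpa using reflection_mul_reflection_mul k 1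

theorem perm_mul_perm (σ τ : Equiv.Perm (Fin 3)) : perm σ * perm τ = perm (τ * σ) := by
  ext1
  funext i
  rw [perm_mul_coord]
  rfl

theorem perm_one : perm 1 = 1 := rfl

/-- `IsReducedWord k F`: `F` is a reduced product of reflections times a permutation of the
coordinates, and `k` is the outermost reflection, if there is any. -/
inductive IsReducedWord : Option (Fin 3) → PolyMap → Prop
  | perm (σ : Equiv.Perm (Fin 3)) : IsReducedWord none (perm σ)
  | reflection {l : Option (Fin 3)} {F : PolyMap} (k : Fin 3) (hk : l ≠ some k)
      (hF : IsReducedWord l F) : IsReducedWord (some k) (reflection k * F)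

theorem IsReducedWord.reflection_mul {l : Option (Fin 3)} {F : PolyMap} (hF : IsReducedWord l F)
    (k : Fin 3) : ∃ l', IsReducedWord l' (PolyMap.reflection k * F) := by
  by_cases hl : l = some k
  · subst hl
    cases hF with
    | reflection _ hk hF => exact ⟨_, by rwa [reflection_mul_reflection_mul]⟩
  · exact ⟨_, .reflection k hl hF⟩

end PolyMap

theorem mem_nielsenTraceMaps_iff {F : PolyMap} : F ∈ nielsenTraceMaps ↔
    MvPolynomial.bind₁ F.coord frickeVogt = frickeVogt ∧ F.evalAt (fun _ => 1) = fun _ => 1 :=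
  Iff.rfl

theorem perm_mem_nielsenTraceMaps (σ : Equiv.Perm (Fin 3)) :
    PolyMap.perm σ ∈ nielsenTraceMaps := by
  rw [mem_nielsenTraceMaps_iff]
  refine ⟨?_, by funext i; simp [PolyMap.evalAt, PolyMap.perm]⟩
  rw [bind₁_frickeVogt, frickeVogt]
  simp only [PolyMap.perm]
  have key : ∀ σ : Equiv.Perm (Fin 3), (σ 0 = 0 ∧ σ 1 = 1 ∧ σ 2 = 2) ∨
      (σ 0 = 0 ∧ σ 1 = 2 ∧ σ 2 = 1) ∨ (σ 0 = 1 ∧ σ 1 = 0 ∧ σ 2 = 2) ∨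
      (σ 0 = 1 ∧ σ 1 = 2 ∧ σ 2 = 0) ∨ (σ 0 = 2 ∧ σ 1 = 0 ∧ σ 2 = 1) ∨
      (σ 0 = 2 ∧ σ 1 = 1 ∧ σ 2 = 0) := by decide
  rcases key σ with ⟨h0, h1, h2⟩ | ⟨h0, h1, h2⟩ | ⟨h0, h1, h2⟩ | ⟨h0, h1, h2⟩ | ⟨h0, h1, h2⟩ |
    ⟨h0, h1, h2⟩ <;> rw [h0, h1, h2] <;> ring

theorem reflection_mem_nielsenTraceMaps (k : Fin 3) :
    PolyMap.reflection k ∈ nielsenTraceMaps := by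
  rw [mem_nielsenTraceMaps_iff]
  constructor
  · rw [bind₁_frickeVogt, frickeVogt]
    fin_cases k <;> simp [PolyMap.reflection, Function.update] <;> ring
  · funext i
    fin_cases k <;> fin_cases i <;> simp [PolyMap.evalAt, PolyMap.reflection, Function.update]

/-! ### Degree descent for the Fricke-Vogt equation -/

section Descent

open MvPolynomial MonomialOrder

theorem degree_frickeVogt_add_one :
    (degLex (σ := Fin 3)).degree (frickeVogt + 1) =
      Finsupp.single 0 1 + Finsupp.single 1 1 + Finsupp.single 2 1 ∧
    (degLex (σ := Fin 3)).leadingCoeff (frickeVogt + 1) = -2 := by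
  have hx : (degLex (σ := Fin 3)).degree
      (C (-2) * (X 0 * X 1 * X 2) : MvPolynomial (Fin 3) ℤ) =
      Finsupp.single 0 1 + Finsupp.single 1 1 + Finsupp.single 2 1 := by
    rw [degree_mul (by simp) (by simp [X_ne_zero]), degree_mul (by simp [X_ne_zero]) (X_ne_zero _),
      degree_mul (X_ne_zero _) (X_ne_zero _)]
    simp only [degree_X, degree_C, zero_add]
  have hl : (degLex (σ := Fin 3)).leadingCoeff
      (C (-2) * (X 0 * X 1 * X 2) : MvPolynomial (Fin 3) ℤ) = -2 := by
    simp only [leadingCoeff_mul, leadingCoeff_X, leadingCoeff_C, mul_one]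
  have hlt : (degLex (σ := Fin 3)).toSyn ((degLex (σ := Fin 3)).degree
      (X 0 ^ 2 + X 1 ^ 2 + X 2 ^ 2 : MvPolynomial (Fin 3) ℤ)) <
      (degLex (σ := Fin 3)).toSyn ((degLex (σ := Fin 3)).degree
      (C (-2) * (X 0 * X 1 * X 2) : MvPolynomial (Fin 3) ℤ)) := by
    rw [hx]
    have hs : ∀ i : Fin 3, (degLex (σ := Fin 3)).toSyn ((degLex (σ := Fin 3)).degree
      (X i ^ 2 : MvPolynomial (Fin 3) ℤ)) < (degLex (σ := Fin 3)).toSyn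
        (Finsupp.single 0 1 + Finsupp.single 1 1 + Finsupp.single 2 1) := by
      intro i
      rw [degree_pow, degree_X, degLex_lt_iff, Finsupp.DegLex.lt_iff]
      left
      simp
    exact lt_of_le_of_lt degree_add_le
      (max_lt (lt_of_le_of_lt degree_add_le (max_lt (hs 0) (hs 1))) (hs 2))
  have he : (frickeVogt + 1 : MvPolynomial (Fin 3) ℤ) =
      C (-2) * (X 0 * X 1 * X 2) + (X 0 ^ 2 + X 1 ^ 2 + X 2 ^ 2) := by
    rw [frickeVogt, map_neg, show (C 2 : MvPolynomial (Fin 3) ℤ) = 2 from map_ofNat C 2]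
    ring
  rw [he, degree_add_of_lt hlt, leadingCoeff_add_of_lt hlt]
  exact ⟨hx, hl⟩

/-- Parity of an exponent. In the descent this excludes every configuration in which a leading
monomial would be a square. -/
theorem two_nsmul_ne_single_sum (d : Fin 3 →₀ ℕ) :
    2 • d ≠ Finsupp.single 0 1 + Finsupp.single 1 1 + Finsupp.single 2 1 := by
  intro h
  have := DFunLike.congr_fun h 0
  simp at this

/-- If three polynomials equal to `1` at `(1, 1, 1)` satisfy the Fricke-Vogt equation and are
sorted by degree, then either the reflection in the last one lowers its degree, or their degrees
are nonzero and add up to the degree of the Fricke-Vogt polynomial. -/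
theorem degree_descent {f g h : MvPolynomial (Fin 3) ℤ}
    (hf : eval (fun _ => 1) f = 1) (hg : eval (fun _ => 1) g = 1) (hh : eval (fun _ => 1) h = 1)
    (H : f ^ 2 + g ^ 2 + h ^ 2 - 2 * f * g * h = frickeVogt + 1)
    (hfg : degLex.toSyn (degLex.degree f) ≤ degLex.toSyn (degLex.degree g))
    (hgh : degLex.toSyn (degLex.degree g) ≤ degLex.toSyn (degLex.degree h)) :
    degLex.toSyn (degLex.degree (2 * f * g - h)) < degLex.toSyn (degLex.degree h) ∨
    (degLex.degree f ≠ 0 ∧ degLex.degree g ≠ 0 ∧ degLex.degree h ≠ 0 ∧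
      degLex.degree f + degLex.degree g + degLex.degree h =
        Finsupp.single 0 1 + Finsupp.single 1 1 + Finsupp.single 2 1 ∧
      degLex.leadingCoeff f * degLex.leadingCoeff g * degLex.leadingCoeff h = 1) := by
  have hf0 : f ≠ 0 := by rintro rfl; simp at hf
  have hg0 : g ≠ 0 := by rintro rfl; simp at hg
  have hh0 : h ≠ 0 := by rintro rfl; simp at hh
  obtain ⟨hP, hlP⟩ := degree_frickeVogt_add_one
  rw [← H] at hP hlP
  set α := degLex.degree f with hα
  set β := degLex.degree g with hβ
  set γ := degLex.degree h with hγ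
  -- The normalization at `(1, 1, 1)` enters here: a constant `f` equals `1`, and then the left side
  -- is `(g - h) ^ 2 + 1`, whose leading exponent is even.
  have hne : α ≠ 0 := by
    intro h0
    have hf1 : f = 1 := by
      have h1 := eq_C_of_degree_eq_zero h0
      rw [h1] at hf
      rw [h1]
      simpa using congrArg (C (σ := Fin 3)) hf
    subst hf1
    have h1 : (1 : MvPolynomial (Fin 3) ℤ) ^ 2 + g ^ 2 + h ^ 2 - 2 * 1 * g * h
        = (g - h) ^ 2 + 1 := by ring
    rw [h1] at hP
    by_cases hd : degLex.degree ((g - h) ^ 2) = 0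
    · have h2 : degLex.degree ((g - h) ^ 2 + 1) = 0 := by
        rw [eq_C_of_degree_eq_zero hd, ← C_1, ← C_add, degree_C]
      rw [h2] at hP
      have := DFunLike.congr_fun hP 0
      simp at this
    · rw [degree_add_of_lt, degree_pow] at hP
      · exact two_nsmul_ne_single_sum _ hP
      · rw [degree_one, map_zero, toSyn_lt_iff_ne_zero, Ne, toSyn_eq_zero_iff]
        exact hd
  have hα0 : 0 < degLex.toSyn α := by
    rw [toSyn_lt_iff_ne_zero, Ne, toSyn_eq_zero_iff]
    exact hne
  have two_ne : (2 : MvPolynomial (Fin 3) ℤ) ≠ 0 := two_ne_zero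
  have deg2 : (degLex (σ := Fin 3)).degree (2 : MvPolynomial (Fin 3) ℤ) = 0 := by
    rw [← map_ofNat (C (σ := Fin 3)) 2, degree_C]
  have hfgd : degLex.degree (2 * f * g) = α + β := by
    rw [degree_mul (mul_ne_zero two_ne hf0) hg0, degree_mul two_ne hf0, deg2, zero_add]
  have hsq : ∀ p : MvPolynomial (Fin 3) ℤ, degLex.toSyn (degLex.degree (p ^ 2)) =
      degLex.toSyn (degLex.degree p) + degLex.toSyn (degLex.degree p) := by
    intro p
    rw [degree_pow, two_nsmul, map_add]
  -- If `f * g` does not exceed `h` and the reflection fails to lower the degree, then `h * (2 * f *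
  -- g - h)` dominates with exponent `2 • γ`, against parity. Otherwise the cubic term dominates all
  -- three squares, so its leading term is that of `-2xyz`.
  rcases le_or_gt (degLex.toSyn (α + β)) (degLex.toSyn γ) with hle | hlt
  · left
    by_contra hcon
    rw [not_lt] at hcon
    have hle' : degLex.toSyn (degLex.degree (2 * f * g - h)) ≤ degLex.toSyn γ := by
      refine degree_sub_le.trans (max_le ?_ le_rfl)
      rw [hfgd]; exact hle
    have heq : degLex.degree (2 * f * g - h) = γ := degLex.toSyn.injective (le_antisymm hle' hcon)
    have hne2 : 2 * f * g - h ≠ 0 := by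
      intro h0
      rw [h0, degree_zero] at heq
      rw [← heq] at hgh
      have := lt_of_lt_of_le hα0 (hfg.trans hgh)
      simp at this
    have hbg : degLex.toSyn β < degLex.toSyn γ := by
      refine lt_of_lt_of_le ?_ hle
      rw [map_add]
      exact lt_add_of_pos_left _ hα0
    have h1 : f ^ 2 + g ^ 2 + h ^ 2 - 2 * f * g * h =
        - (h * (2 * f * g - h)) + (f ^ 2 + g ^ 2) := by ring
    rw [h1, degree_add_of_lt, degree_neg, degree_mul hh0 hne2, heq, ← hγ, ← two_nsmul] at hP
    · exact two_nsmul_ne_single_sum _ hP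
    · rw [degree_neg, degree_mul hh0 hne2, heq, map_add]
      refine lt_of_le_of_lt degree_add_le (max_lt ?_ ?_)
      · rw [hsq]
        exact add_lt_add (lt_of_le_of_lt hfg hbg) (lt_of_le_of_lt hfg hbg)
      · rw [hsq]
        exact add_lt_add hbg hbg
  · right
    have hβ0 := lt_of_lt_of_le hα0 hfg
    have hγ0 := lt_of_lt_of_le hβ0 hgh
    have h1 : f ^ 2 + g ^ 2 + h ^ 2 - 2 * f * g * h =
        - (2 * f * g * h) + (f ^ 2 + g ^ 2 + h ^ 2) := by ring
    have hd : degLex.degree (2 * f * g * h) = α + β + γ := by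
      rw [degree_mul (mul_ne_zero (mul_ne_zero two_ne hf0) hg0) hh0, hfgd]
    have hlt' : degLex.toSyn (degLex.degree (f ^ 2 + g ^ 2 + h ^ 2)) <
        degLex.toSyn (degLex.degree (- (2 * f * g * h))) := by
      rw [degree_neg, hd, map_add]
      have hγγ := add_lt_add_left hlt (degLex.toSyn γ)
      have hmono : ∀ p : MvPolynomial (Fin 3) ℤ, degLex.toSyn (degLex.degree p) ≤ degLex.toSyn γ →
          degLex.toSyn (degLex.degree (p ^ 2)) < degLex.toSyn (α + β) + degLex.toSyn γ := by
        intro p hp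
        rw [hsq]
        exact lt_of_le_of_lt (add_le_add hp hp) hγγ
      exact lt_of_le_of_lt degree_add_le (max_lt (lt_of_le_of_lt degree_add_le
        (max_lt (hmono f (hfg.trans hgh)) (hmono g hgh))) (hmono h le_rfl))
    rw [h1, degree_add_of_lt hlt', degree_neg, hd] at hP
    rw [h1, leadingCoeff_add_of_lt hlt', leadingCoeff_neg, leadingCoeff_mul, leadingCoeff_mul,
      leadingCoeff_mul] at hlP
    refine ⟨hne, ?_, ?_, hP, ?_⟩
    · rintro h0
      rw [h0, map_zero] at hβ0
      exact lt_irrefl _ hβ0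
    · rintro h0
      rw [h0, map_zero] at hγ0
      exact lt_irrefl _ hγ0
    · have : (degLex (σ := Fin 3)).leadingCoeff (2 : MvPolynomial (Fin 3) ℤ) = 2 := by
        rw [← map_ofNat (C (σ := Fin 3)) 2, leadingCoeff_C]
      rw [this] at hlP
      linarith

/-- A polynomial whose degree is that of the variable `X j` is affine. -/
theorem eq_affine_of_degree_eq_single {f : MvPolynomial (Fin 3) ℤ} {j : Fin 3}
    (hf : degLex.degree f = Finsupp.single j 1) :
    ∃ (a : Fin 3 → ℤ) (d : ℤ), (∀ i, i < j → a i = 0) ∧ a j = degLex.leadingCoeff f ∧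
      f = C (a 0) * X 0 + C (a 1) * X 1 + C (a 2) * X 2 + C d := by
  -- In `degLex` the variable of smaller index is the larger one; this makes the affine system below
  -- triangular.
  have hlt : ∀ i, i < j → coeff (Finsupp.single i 1) f = 0 := by
    intro i hi
    apply degLex.coeff_eq_zero_of_lt
    rw [hf]
    exact degLex_single_lt_iff.2 hi
  refine ⟨fun i => coeff (Finsupp.single i 1) f, coeff 0 f, hlt, ?_, ?_⟩
  · rw [MonomialOrder.leadingCoeff, hf]
  · have key : ∀ d : Fin 3 →₀ ℕ, d = 0 ∨ (∃ i, d = Finsupp.single i 1) ∨ 1 < d.degree := by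
      intro d
      rcases Nat.lt_trichotomy d.degree 1 with h | h | h
      · left; rw [Nat.lt_one_iff] at h; exact (Finsupp.degree_eq_zero_iff d).1 h
      · right; left
        have h0 : d ≠ 0 := by rintro rfl; simp at h
        obtain ⟨i, hi⟩ := Finsupp.ne_iff.1 h0
        have hle : Finsupp.single i 1 ≤ d := by
          rw [Finsupp.single_le_iff]
          exact Nat.one_le_iff_ne_zero.2 hi
        refine ⟨i, ?_⟩
        have hsub := tsub_add_cancel_of_le hle
        have hdeg := congrArg Finsupp.degree hsub
        rw [map_add, Finsupp.degree_single, h] at hdeg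
        rw [(Finsupp.degree_eq_zero_iff _).1 (Nat.add_eq_right.1 hdeg), zero_add] at hsub
        exact hsub.symm
      · exact Or.inr (Or.inr h)
    ext d
    simp only [coeff_add, coeff_C_mul, coeff_X, coeff_C]
    rcases key d with rfl | ⟨i, rfl⟩ | h
    · simp
    · have h0 : (0 : Fin 3 →₀ ℕ) ≠ Finsupp.single i 1 := by
        intro h
        have := congrArg Finsupp.degree h
        simp at this
      rw [if_neg h0]
      fin_cases i <;> simp [Finsupp.single_left_inj]
    · rw [degLex.coeff_eq_zero_of_lt (by
        rw [hf, degLex_lt_iff, Finsupp.DegLex.lt_iff]; left; simpa using h)]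
      have h1 : ∀ i, Finsupp.single i 1 ≠ d := by rintro i rfl; simp at h
      have h0 : 0 ≠ d := by rintro rfl; simp at h
      simp [h1, h0]

end Descent

/-! ### Affine solutions of the Fricke-Vogt equation -/

section Generation

open MvPolynomial MonomialOrder

/-- A triangular affine solution of the Fricke-Vogt equation fixing `(1, 1, 1)` is the identity. -/
theorem affine_coeff_of_frickeVogt {e₁ b₁ c₁ d₁ e₂ c₂ d₂ e₃ d₃ : ℤ} (he : e₁ * e₂ * e₃ = 1)
    (hf : e₁ + b₁ + c₁ + d₁ = 1) (hg : e₂ + c₂ + d₂ = 1) (hh : e₃ + d₃ = 1)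
    (H : ∀ x y z : ℤ, (e₁ * x + b₁ * y + c₁ * z + d₁) ^ 2 + (e₂ * y + c₂ * z + d₂) ^ 2 +
      (e₃ * z + d₃) ^ 2 - 2 * (e₁ * x + b₁ * y + c₁ * z + d₁) * (e₂ * y + c₂ * z + d₂) *
      (e₃ * z + d₃) = x ^ 2 + y ^ 2 + z ^ 2 - 2 * x * y * z) :
    (e₁ = 1 ∧ b₁ = 0 ∧ c₁ = 0 ∧ d₁ = 0) ∧ (e₂ = 1 ∧ c₂ = 0 ∧ d₂ = 0) ∧ (e₃ = 1 ∧ d₃ = 0) := by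
  have h1 : e₁ ≠ 0 := by rintro rfl; simp at he
  have h2 : e₂ ≠ 0 := by rintro rfl; simp at he
  have h3 : e₃ ≠ 0 := by rintro rfl; simp at he
  -- Signed sums over points with coordinates in `{0, 1, -1}` isolate one coefficient at a time, in
  -- turn those of `xz²`, `y²z`, `yz²`, `xy`, `xz`, `yz`. All are absent from the right side.
  obtain rfl : c₂ = 0 := by
    have h : e₁ * e₃ * c₂ = 0 := by
      linarith [H 1 0 1, H (-1) 0 1, H 1 0 (-1), H (-1) 0 (-1), H 1 0 0, H (-1) 0 0]
    simpa [h1, h3] using h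
  obtain rfl : b₁ = 0 := by
    have h : e₂ * e₃ * b₁ = 0 := by
      linarith [H 0 1 1, H 0 1 (-1), H 0 (-1) 1, H 0 (-1) (-1), H 0 0 1, H 0 0 (-1)]
    simpa [h2, h3] using h
  obtain rfl : c₁ = 0 := by
    have h : e₂ * e₃ * c₁ = 0 := by
      linarith [H 0 1 1, H 0 1 (-1), H 0 (-1) 1, H 0 (-1) (-1), H 0 1 0, H 0 (-1) 0]
    simpa [h2, h3] using h
  obtain rfl : d₃ = 0 := by
    have h : e₁ * e₂ * d₃ = 0 := by
      linarith [H 1 1 0, H 1 (-1) 0, H (-1) 1 0, H (-1) (-1) 0]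
    simpa [h1, h2] using h
  obtain rfl : d₂ = 0 := by
    have h : e₁ * e₃ * d₂ = 0 := by
      linarith [H 1 0 1, H 1 0 (-1), H (-1) 0 1, H (-1) 0 (-1)]
    simpa [h1, h3] using h
  obtain rfl : d₁ = 0 := by
    have h : e₂ * e₃ * d₁ = 0 := by
      linarith [H 0 1 1, H 0 1 (-1), H 0 (-1) 1, H 0 (-1) (-1)]
    simpa [h2, h3] using h
  simp_all

/-- If the degrees of a solution of the Fricke-Vogt equation are those of `x`, `y`, `z`, the
solution is `x`, `y`, `z`. -/
theorem eq_X_of_degree_eq_single {f g h : MvPolynomial (Fin 3) ℤ}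
    (hf : eval (fun _ => 1) f = 1) (hg : eval (fun _ => 1) g = 1) (hh : eval (fun _ => 1) h = 1)
    (H : f ^ 2 + g ^ 2 + h ^ 2 - 2 * f * g * h = frickeVogt + 1)
    (hdf : degLex.degree f = Finsupp.single 0 1) (hdg : degLex.degree g = Finsupp.single 1 1)
    (hdh : degLex.degree h = Finsupp.single 2 1)
    (hl : degLex.leadingCoeff f * degLex.leadingCoeff g * degLex.leadingCoeff h = 1) :
    f = X 0 ∧ g = X 1 ∧ h = X 2 := by
  obtain ⟨a, d₁, -, hla, rfl⟩ := eq_affine_of_degree_eq_single hdf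
  obtain ⟨b, d₂, hb, hlb, rfl⟩ := eq_affine_of_degree_eq_single hdg
  obtain ⟨c, d₃, hc, hlc, rfl⟩ := eq_affine_of_degree_eq_single hdh
  rw [← hla, ← hlb, ← hlc] at hl
  rw [hb 0 (by decide), hc 0 (by decide), hc 1 (by decide)] at *
  have hev : ∀ x y z : ℤ, _ := fun x y z => congrArg (eval ![x, y, z]) H
  simp only [frickeVogt, map_add, map_sub, map_mul, map_pow, eval_C, eval_X, map_ofNat,
    Matrix.cons_val_zero, Matrix.cons_val_one, Matrix.cons_val, zero_mul, zero_add,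
    sub_add_cancel] at hev
  simp only [map_add, map_mul, eval_C, eval_X, mul_one, zero_add] at hf hg hh
  obtain ⟨⟨h1, h2, h3, h4⟩, ⟨h5, h6, h7⟩, ⟨h8, h9⟩⟩ :=
    affine_coeff_of_frickeVogt hl hf hg hh hev
  simp [h1, h2, h3, h4, h5, h6, h7, h8, h9]

/-- Three nonzero exponents of total degree 3 all have degree 1, so each is a variable; as the sum
is that of `xyz`, every variable occurs. -/
theorem exists_perm_degree_eq_single {d : Fin 3 → Fin 3 →₀ ℕ} (hd : ∀ i, d i ≠ 0)
    (hs : d 0 + d 1 + d 2 = Finsupp.single 0 1 + Finsupp.single 1 1 + Finsupp.single 2 1) :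
    ∃ σ : Equiv.Perm (Fin 3), ∀ i, d (σ i) = Finsupp.single i 1 := by
  have hpos : ∀ i, 0 < (d i).degree := fun i =>
    Nat.pos_of_ne_zero fun h => hd i ((Finsupp.degree_eq_zero_iff _).1 h)
  have hdeg : (d 0).degree + (d 1).degree + (d 2).degree = 3 := by
    have := congrArg Finsupp.degree hs
    simpa only [map_add, Finsupp.degree_single] using this
  have hone : ∀ i, (d i).degree = 1 := by
    intro i
    have h0 := hpos 0
    have h1 := hpos 1
    have h2 := hpos 2
    fin_cases i <;> simp only [Fin.zero_eta, Fin.mk_one, Fin.reduceFinMk] <;> omega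
  have hsingle : ∀ i, ∃ j, d i = Finsupp.single j 1 := by
    intro i
    have := Set.mem_range.1 ((Finsupp.range_single_one (σ := Fin 3)).ge (hone i))
    obtain ⟨j, hj⟩ := this
    exact ⟨j, hj.symm⟩
  choose τ hτ using hsingle
  have hsurj : Function.Surjective τ := by
    intro j
    by_contra hcon
    push Not at hcon
    have := DFunLike.congr_fun hs j
    rw [hτ 0, hτ 1, hτ 2] at this
    simp only [Finsupp.add_apply, Finsupp.single_apply, hcon, if_false] at this
    fin_cases j <;> simp at this
  refine ⟨(Equiv.ofBijective τ (Finite.injective_iff_bijective.1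
    (Finite.injective_iff_surjective.2 hsurj))).symm, fun i => ?_⟩
  rw [hτ]
  congr 1
  exact Equiv.ofBijective_apply_symm_apply τ _ i

end Generation

/-! ### Factorization and invertibility of Nielsen trace maps -/

namespace PolyMap

open MvPolynomial MonomialOrder

theorem frickeVogt_equation {F : PolyMap} (hF : F ∈ nielsenTraceMaps)
    (σ : Equiv.Perm (Fin 3)) : F.coord (σ 0) ^ 2 + F.coord (σ 1) ^ 2 + F.coord (σ 2) ^ 2 -
      2 * F.coord (σ 0) * F.coord (σ 1) * F.coord (σ 2) = frickeVogt + 1 := by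
  have h := (mem_nielsenTraceMaps_iff.1 (mul_mem (perm_mem_nielsenTraceMaps σ) hF)).1
  rw [bind₁_frickeVogt, perm_mul_coord, perm_mul_coord, perm_mul_coord] at h
  rw [← h]
  ring

/-- The sum of the degrees of the coordinates. -/
noncomputable def degreeSum (F : PolyMap) : (degLex (σ := Fin 3)).syn :=
  ∑ i, degLex.toSyn (degLex.degree (F.coord i))

theorem degreeSum_reflection_mul_lt {F : PolyMap} {k : Fin 3}
    (h : degLex.toSyn (degLex.degree ((reflection k * F).coord k)) <
      degLex.toSyn (degLex.degree (F.coord k))) : (reflection k * F).degreeSum < F.degreeSum := by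
  refine Finset.sum_lt_sum (fun i _ => ?_) ⟨k, Finset.mem_univ _, h⟩
  by_cases hi : i = k
  · subst hi; exact h.le
  · rw [reflection_mul_coord_of_ne hi]

theorem exists_sort {α : Type*} [LinearOrder α] (f : Fin 3 → α) :
    ∃ σ : Equiv.Perm (Fin 3), f (σ 0) ≤ f (σ 1) ∧ f (σ 1) ≤ f (σ 2) :=
  ⟨Tuple.sort f, Tuple.monotone_sort f (by decide : (0 : Fin 3) ≤ 1),
    Tuple.monotone_sort f (by decide : (1 : Fin 3) ≤ 2)⟩

/-- Nielsen trace maps are products of reflections and of permutations of the coordinates. -/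
theorem exists_isReducedWord {F : PolyMap} (hF : F ∈ nielsenTraceMaps) :
    ∃ l, IsReducedWord l F := by
  -- The monomial order is a well-order, so the sum of the three degrees can serve as the descent
  -- measure.
  induction hs : F.degreeSum using WellFoundedLT.induction generalizing F with
  | ind s ih =>
  subst hs
  obtain ⟨σ, h01, h12⟩ := exists_sort fun i => degLex.toSyn (degLex.degree (F.coord i))
  have heval : ∀ i, eval (fun _ => 1) (F.coord i) = 1 := fun i => congrFun hF.2 i
  rcases degree_descent (heval (σ 0)) (heval (σ 1)) (heval (σ 2)) (frickeVogt_equation hF σ)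
    h01 h12 with h | ⟨h0, h1, h2, hsum, hl⟩
  · have hmem := mul_mem (reflection_mem_nielsenTraceMaps (σ 2)) hF
    have hlt : (reflection (σ 2) * F).degreeSum < F.degreeSum := by
      apply degreeSum_reflection_mul_lt
      rw [reflection_mul_coord_self]
      have key : ∀ σ : Equiv.Perm (Fin 3), (σ 2 + 1 = σ 0 ∧ σ 2 + 2 = σ 1) ∨
          (σ 2 + 1 = σ 1 ∧ σ 2 + 2 = σ 0) := by decide
      rcases key σ with ⟨ha, hb⟩ | ⟨ha, hb⟩
      · rw [ha, hb]; exact h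
      · rw [ha, hb, mul_right_comm]; exact h
    obtain ⟨l, hl⟩ := ih _ hlt hmem rfl
    obtain ⟨l', hl'⟩ := hl.reflection_mul (σ 2)
    rw [reflection_mul_reflection_mul] at hl'
    exact ⟨l', hl'⟩
  -- The descent has ended: after a permutation the coordinates have the degrees of `x`, `y`, `z`,
  -- hence are these variables.
  · obtain ⟨τ, hτ⟩ := exists_perm_degree_eq_single
      (d := fun i => degLex.degree (F.coord (σ i)))
      (by intro i; fin_cases i <;> assumption) hsum
    have hl' : degLex.leadingCoeff (F.coord ((σ * τ) 0)) *
        degLex.leadingCoeff (F.coord ((σ * τ) 1)) *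
        degLex.leadingCoeff (F.coord ((σ * τ) 2)) = 1 := by
      have h3 : ∀ ρ : Equiv.Perm (Fin 3), degLex.leadingCoeff (F.coord (ρ 0)) *
        degLex.leadingCoeff (F.coord (ρ 1)) * degLex.leadingCoeff (F.coord (ρ 2)) =
          ∏ i, degLex.leadingCoeff (F.coord i) := by
        intro ρ
        rw [← Equiv.prod_comp ρ, Fin.prod_univ_three]
      rw [h3, ← h3 σ]
      exact hl
    obtain ⟨e0, e1, e2⟩ := eq_X_of_degree_eq_single (heval _) (heval _) (heval _)
      (frickeVogt_equation hF (σ * τ)) (hτ 0) (hτ 1) (hτ 2) hl'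
    refine ⟨none, ?_⟩
    have : perm (σ * τ) * F = 1 := by
      ext1
      funext i
      rw [perm_mul_coord, one_coord]
      fin_cases i <;> assumption
    have hF' : F = perm (σ * τ)⁻¹ := by
      have h := congrArg (perm (σ * τ)⁻¹ * ·) this
      simpa [← mul_assoc, perm_mul_perm, perm_one] using h
    rw [hF']
    exact .perm _

/-- Every Nielsen trace map is invertible. -/
theorem exists_inverse_of_isReducedWord {l : Option (Fin 3)} {F : PolyMap}
    (hF : IsReducedWord l F) : ∃ G ∈ nielsenTraceMaps, G * F = 1 ∧ F * G = 1 := by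
  induction hF with
  | perm σ => exact ⟨perm σ⁻¹, perm_mem_nielsenTraceMaps _, by simp [perm_mul_perm, perm_one],
      by simp [perm_mul_perm, perm_one]⟩
  | @reflection _ F k _ _ ih =>
    obtain ⟨G, hG, h1, h2⟩ := ih
    refine ⟨G * reflection k, mul_mem hG (reflection_mem_nielsenTraceMaps k), ?_, ?_⟩
    · rw [mul_assoc, reflection_mul_reflection_mul, h1]
    · rw [mul_assoc, ← mul_assoc F, h2, one_mul, reflection_mul_self]

end PolyMap

/-- Every Nielsen trace map is invertible. -/
theorem isUnit_nielsenTraceMaps (F : nielsenTraceMaps) : IsUnit F := by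
  obtain ⟨l, hl⟩ := PolyMap.exists_isReducedWord F.2
  obtain ⟨G, hG, h1, h2⟩ := PolyMap.exists_inverse_of_isReducedWord hl
  exact isUnit_iff_exists.2 ⟨⟨G, hG⟩, Subtype.ext h2, Subtype.ext h1⟩

/-! ### Action on the tangent cone at `(1, 1, 1)` -/

section DualNumbers

open MvPolynomial

/-- The dual number `1 + a ε`. -/
def oneAddEps (a : ℤ) : DualNumber ℤ := TrivSqZeroExt.inl 1 + TrivSqZeroExt.inr a

theorem snd_oneAddEps (a : ℤ) : (oneAddEps a).snd = a := by simp [oneAddEps]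

theorem oneAddEps_injective : Function.Injective oneAddEps := fun a b h => by
  rw [← snd_oneAddEps a, h, snd_oneAddEps]

/-- Linearizing a reflection at `(1, 1, 1)` gives the parallelogram law: from `u²`, `v²`, `(u + v)²`
it produces `(u - v)²`. This is why reflections act on the cone by integral matrices. -/
theorem two_mul_oneAddEps_mul_sub (a b c : ℤ) :
    2 * oneAddEps a * oneAddEps b - oneAddEps c = oneAddEps (2 * a + 2 * b - c) := by
  rw [two_mul, add_mul]
  ext
  · simp [oneAddEps]
  · simp only [oneAddEps, TrivSqZeroExt.snd_sub, TrivSqZeroExt.snd_add, TrivSqZeroExt.snd_mul,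
      TrivSqZeroExt.fst_add, TrivSqZeroExt.fst_inl, TrivSqZeroExt.fst_inr, TrivSqZeroExt.snd_inl,
      TrivSqZeroExt.snd_inr, smul_eq_mul, MulOpposite.smul_eq_mul_unop, MulOpposite.unop_op]
    ring

/-- The tangent vector at the singular point `(1, 1, 1)` of the surface `I = 0` with direction
`(u ^ 2, v ^ 2, (u + v) ^ 2)`, as a point over the dual numbers. -/
def dualPoint (w : Fin 2 → ℤ) : Fin 3 → DualNumber ℤ :=
  fun i => oneAddEps (![w 0, w 1, w 0 + w 1] i ^ 2)

theorem dualPoint_neg (w : Fin 2 → ℤ) : dualPoint (-w) = dualPoint w := by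
  funext i
  fin_cases i <;> simp [dualPoint]
  congr 1
  ring

/-- The image of a point over the dual numbers under a polynomial mapping. -/
noncomputable def PolyMap.dualEval (F : PolyMap) (p : Fin 3 → DualNumber ℤ) :
    Fin 3 → DualNumber ℤ := fun i => aeval p (F.coord i)

theorem PolyMap.dualEval_mul (F G : PolyMap) (p : Fin 3 → DualNumber ℤ) :
    (F * G).dualEval p = F.dualEval (G.dualEval p) := by
  funext i
  simp only [PolyMap.dualEval, PolyMap.mul_coord]
  exact aeval_bind₁ _ _ _

theorem PolyMap.dualEval_one (p : Fin 3 → DualNumber ℤ) : (1 : PolyMap).dualEval p = p := by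
  funext i
  simp [PolyMap.dualEval, PolyMap.one_coord]

/-- `F` acts on the tangent cone at `(1, 1, 1)` through the integral matrix `M`. -/
def Represents (F : PolyMap) (M : Matrix (Fin 2) (Fin 2) ℤ) : Prop :=
  ∀ w, F.dualEval (dualPoint w) = dualPoint (M.mulVec w)

theorem Represents.mul {F G : PolyMap} {M N : Matrix (Fin 2) (Fin 2) ℤ} (hF : Represents F M)
    (hG : Represents G N) : Represents (F * G) (M * N) := by
  intro w
  rw [PolyMap.dualEval_mul, hG, hF, Matrix.mulVec_mulVec]

theorem represents_one : Represents 1 1 := by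
  intro w
  rw [PolyMap.dualEval_one, Matrix.one_mulVec]

theorem Represents.neg {F : PolyMap} {M : Matrix (Fin 2) (Fin 2) ℤ} (hF : Represents F M) :
    Represents F (-M) := by
  intro w
  rw [hF, Matrix.neg_mulVec, dualPoint_neg]

theorem Represents.eq_one_or_eq_neg_one {M : Matrix (Fin 2) (Fin 2) ℤ} (h : Represents 1 M) :
    M = 1 ∨ M = -1 := by
  have key : ∀ w i, ![w 0, w 1, w 0 + w 1] i ^ 2 =
      ![M.mulVec w 0, M.mulVec w 1, M.mulVec w 0 + M.mulVec w 1] i ^ 2 := by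
    intro w i
    have := h w
    rw [PolyMap.dualEval_one] at this
    exact oneAddEps_injective (congrFun this i)
  -- The two basis vectors give the entries up to sign; `(1, 1)` shows that the diagonal signs
  -- agree.
  have h1 := key ![1, 0] 0
  have h2 := key ![1, 0] 1
  have h3 := key ![0, 1] 0
  have h4 := key ![0, 1] 1
  have h5 := key ![1, 1] 2
  simp only [Matrix.mulVec, dotProduct, Fin.sum_univ_two, Matrix.cons_val_zero,
    Matrix.cons_val_one, Matrix.cons_val, mul_one, mul_zero, add_zero, zero_add,
    one_pow] at h1 h2 h3 h4 h5
  have hb : M 1 0 = 0 := by nlinarith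
  have hc : M 0 1 = 0 := by nlinarith
  rw [hb, hc] at h5
  have hd : M 0 0 = M 1 1 := by nlinarith
  rcases sq_eq_sq_iff_eq_or_eq_neg.1 (h1.symm.trans (one_pow 2).symm) with ha | ha
  · left
    ext i j
    fin_cases i <;> fin_cases j <;> simp [← hd, ha, hb, hc]
  · right
    ext i j
    fin_cases i <;> fin_cases j <;> simp [← hd, ha, hb, hc]

theorem dualEval_reflection_mul {F : PolyMap} {p : Fin 3 → DualNumber ℤ} {a : Fin 3 → ℤ}
    (h : F.dualEval p = fun i => oneAddEps (a i)) (k : Fin 3) :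
    (PolyMap.reflection k * F).dualEval p =
      fun i => oneAddEps (Function.update a k (2 * a (k + 1) + 2 * a (k + 2) - a k) i) := by
  have h' : ∀ i, aeval p (F.coord i) = oneAddEps (a i) := congrFun h
  funext i
  by_cases hi : i = k
  · subst hi
    have h2 : aeval p (2 : MvPolynomial (Fin 3) ℤ) = 2 := map_ofNat _ 2
    rw [PolyMap.dualEval, PolyMap.reflection_mul_coord_self, Function.update_self]
    simp only [map_sub, map_mul, h2, h', two_mul_oneAddEps_mul_sub]
  · rw [PolyMap.dualEval, PolyMap.reflection_mul_coord_of_ne hi, Function.update_of_ne hi, h']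

theorem exists_represents_perm (σ : Equiv.Perm (Fin 3)) :
    ∃ M : GL (Fin 2) ℤ, Represents (PolyMap.perm σ) (M : Matrix (Fin 2) (Fin 2) ℤ) := by
  have h : ∀ p : Fin 3 → DualNumber ℤ, (PolyMap.perm σ).dualEval p = fun i => p (σ i) := by
    intro p
    funext i
    simp [PolyMap.dualEval, PolyMap.perm]
  have key : ∀ σ : Equiv.Perm (Fin 3), (σ 0 = 0 ∧ σ 1 = 1 ∧ σ 2 = 2) ∨
      (σ 0 = 0 ∧ σ 1 = 2 ∧ σ 2 = 1) ∨ (σ 0 = 1 ∧ σ 1 = 0 ∧ σ 2 = 2) ∨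
      (σ 0 = 1 ∧ σ 1 = 2 ∧ σ 2 = 0) ∨ (σ 0 = 2 ∧ σ 1 = 0 ∧ σ 2 = 1) ∨
      (σ 0 = 2 ∧ σ 1 = 1 ∧ σ 2 = 0) := by decide
  have main : ∀ A : Matrix (Fin 2) (Fin 2) ℤ, IsUnit A.det →
      (∀ w : Fin 2 → ℤ, ∀ i, ![w 0, w 1, w 0 + w 1] (σ i) ^ 2 =
        ![A.mulVec w 0, A.mulVec w 1, A.mulVec w 0 + A.mulVec w 1] i ^ 2) →
      ∃ M : GL (Fin 2) ℤ, Represents (PolyMap.perm σ) (M : Matrix (Fin 2) (Fin 2) ℤ) := by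
    intro A hA hw
    refine ⟨Matrix.GeneralLinearGroup.mk'' A hA, fun w => ?_⟩
    rw [h]
    funext i
    exact congrArg oneAddEps (hw w i)
  rcases key σ with ⟨h0, h1, h2⟩ | ⟨h0, h1, h2⟩ | ⟨h0, h1, h2⟩ | ⟨h0, h1, h2⟩ | ⟨h0, h1, h2⟩ |
    ⟨h0, h1, h2⟩
  · exact main !![1, 0; 0, 1] (by simp) fun w i => by
      fin_cases i <;> simp [h0, h1, h2, Matrix.mulVec, dotProduct, Fin.sum_univ_two]
  · exact main !![1, 0; -1, -1] (by simp) fun w i => by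
      fin_cases i <;> simp [h0, h1, h2, Matrix.mulVec, dotProduct, Fin.sum_univ_two]
      ring
  · exact main !![0, 1; 1, 0] (by simp) fun w i => by
      fin_cases i <;> simp [h0, h1, h2, Matrix.mulVec, dotProduct, Fin.sum_univ_two]
      ring
  · exact main !![0, 1; -1, -1] (by simp) fun w i => by
      fin_cases i <;> simp [h0, h1, h2, Matrix.mulVec, dotProduct, Fin.sum_univ_two]
      ring
  · exact main !![1, 1; -1, 0] (by simp) fun w i => by
      fin_cases i <;> simp [h0, h1, h2, Matrix.mulVec, dotProduct, Fin.sum_univ_two]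
  · exact main !![1, 1; 0, -1] (by simp) fun w i => by
      fin_cases i <;> simp [h0, h1, h2, Matrix.mulVec, dotProduct, Fin.sum_univ_two]

theorem exists_represents_reflection (k : Fin 3) :
    ∃ M : GL (Fin 2) ℤ, Represents (PolyMap.reflection k) (M : Matrix (Fin 2) (Fin 2) ℤ) := by
  have main : ∀ A : Matrix (Fin 2) (Fin 2) ℤ, IsUnit A.det →
      (∀ w : Fin 2 → ℤ, ∀ i, Function.update (fun i => ![w 0, w 1, w 0 + w 1] i ^ 2) k
        (2 * ![w 0, w 1, w 0 + w 1] (k + 1) ^ 2 + 2 * ![w 0, w 1, w 0 + w 1] (k + 2) ^ 2 -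
          ![w 0, w 1, w 0 + w 1] k ^ 2) i =
        ![A.mulVec w 0, A.mulVec w 1, A.mulVec w 0 + A.mulVec w 1] i ^ 2) →
      ∃ M : GL (Fin 2) ℤ,
        Represents (PolyMap.reflection k) (M : Matrix (Fin 2) (Fin 2) ℤ) := by
    intro A hA hw
    refine ⟨Matrix.GeneralLinearGroup.mk'' A hA, fun w => ?_⟩
    rw [← mul_one (PolyMap.reflection k),
      dualEval_reflection_mul (PolyMap.dualEval_one (dualPoint w))]
    funext i
    exact congrArg oneAddEps (hw w i)
  fin_cases k
  · exact main !![1, 2; 0, -1] (by simp) fun w i => by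
      fin_cases i <;>
        simp [Function.update, Matrix.mulVec, dotProduct, Fin.sum_univ_two] <;> ring
  · exact main !![-1, 0; 2, 1] (by simp) fun w i => by
      fin_cases i <;>
        simp [Function.update, Matrix.mulVec, dotProduct, Fin.sum_univ_two] <;> ring
  · exact main !![1, 0; 0, -1] (by simp) fun w i => by
      fin_cases i <;>
        simp [Function.update, Matrix.mulVec, dotProduct, Fin.sum_univ_two]
      ring

theorem PolyMap.IsReducedWord.exists_represents {l : Option (Fin 3)} {F : PolyMap}
    (hF : PolyMap.IsReducedWord l F) :
    ∃ M : GL (Fin 2) ℤ, Represents F (M : Matrix (Fin 2) (Fin 2) ℤ) := by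
  induction hF with
  | perm σ => exact exists_represents_perm σ
  | reflection k _ _ ih =>
    obtain ⟨M, hM⟩ := ih
    obtain ⟨N, hN⟩ := exists_represents_reflection k
    exact ⟨N * M, hN.mul hM⟩

/-- The sum of the values of the dual part of `F` at the three shortest vectors of the hexagonal
lattice. -/
noncomputable def hexLabel (F : PolyMap) (i : Fin 3) : ℤ :=
  (F.dualEval (dualPoint ![1, 0]) i).snd + (F.dualEval (dualPoint ![0, 1]) i).snd +
    (F.dualEval (dualPoint ![1, -1]) i).snd

theorem Represents.hexLabel_nonneg {F : PolyMap} {M : Matrix (Fin 2) (Fin 2) ℤ}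
    (h : Represents F M) (i : Fin 3) : 0 ≤ hexLabel F i := by
  rw [hexLabel, h, h, h]
  simp only [dualPoint, snd_oneAddEps]
  positivity

/-- The three vectors are chosen so that the labels of the identity coincide; then permutations do
not affect the start of the growth argument. -/
theorem hexLabel_one (i : Fin 3) : hexLabel 1 i = 2 := by
  simp only [hexLabel, PolyMap.dualEval_one, dualPoint, snd_oneAddEps]
  fin_cases i <;> simp

theorem hexLabel_perm (σ : Equiv.Perm (Fin 3)) (i : Fin 3) :
    hexLabel (PolyMap.perm σ) i = 2 := by
  rw [← hexLabel_one (σ i)]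
  simp [hexLabel, PolyMap.dualEval, PolyMap.perm, PolyMap.one_coord]

theorem Represents.hexLabel_reflection_mul {F : PolyMap} {M : Matrix (Fin 2) (Fin 2) ℤ}
    (h : Represents F M) (k : Fin 3) : hexLabel (PolyMap.reflection k * F) k =
      2 * hexLabel F (k + 1) + 2 * hexLabel F (k + 2) - hexLabel F k := by
  simp only [hexLabel, dualEval_reflection_mul (h _), h _, dualPoint, snd_oneAddEps,
    Function.update_self]
  ring

theorem hexLabel_reflection_mul_of_ne {i k : Fin 3} (h : i ≠ k) (F : PolyMap) :
    hexLabel (PolyMap.reflection k * F) i = hexLabel F i := by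
  simp only [hexLabel, PolyMap.dualEval, PolyMap.reflection_mul_coord_of_ne h]

/-- In a nonempty reduced word the label of the outermost reflection exceeds the other two. -/
theorem PolyMap.IsReducedWord.hexLabel_lt {l : Option (Fin 3)} {F : PolyMap}
    (hF : PolyMap.IsReducedWord l F) : ∀ k ∈ l, ∀ i, i ≠ k → hexLabel F i < hexLabel F k := by
  induction hF with
  | perm σ => simp
  | @reflection l F k hk hF ih =>
    intro k' hk' i hi
    obtain rfl : k = k' := by simpa using hk'
    obtain ⟨M, hM⟩ := hF.exists_represents
    rw [hexLabel_reflection_mul_of_ne hi, hM.hexLabel_reflection_mul]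
    have hpos := hM.hexLabel_nonneg
    have hcases : ∀ i k : Fin 3, i ≠ k → i = k + 1 ∨ i = k + 2 := by decide
    have h1 : k + 1 ≠ k := by simp
    have h2 : k + 2 ≠ k := by simp
    have h12 : k + 1 ≠ k + 2 := by simp
    have hi' : hexLabel F i = hexLabel F (k + 1) ∨ hexLabel F i = hexLabel F (k + 2) := by
      rcases hcases i k hi with rfl | rfl <;> simp
    have hp1 := hpos (k + 1)
    have hp2 := hpos (k + 2)
    -- With a permutation inside, the new label is `2·2 + 2·2 - 2 = 6 > 2`. Otherwise the label at
    -- the previous reflection `m ≠ k` is the largest, so it exceeds the one being subtracted.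
    cases hF with
    | perm σ => simp only [hexLabel_perm]; norm_num
    | reflection m hm hF =>
      have hmk : m ≠ k := fun h => hk (by rw [h])
      have hlt := ih m rfl
      rcases hcases m k hmk with rfl | rfl
      · have := hlt k h1.symm
        have := hlt (k + 2) h12.symm
        omega
      · have := hlt k h2.symm
        have := hlt (k + 1) h12
        omega

/-- A Nielsen trace map acting trivially on the tangent cone is the identity. -/
theorem eq_one_of_represents_one {F : PolyMap} (hF : F ∈ nielsenTraceMaps)
    (h : Represents F 1) : F = 1 := by
  have hval : ∀ w, F.dualEval (dualPoint w) = dualPoint w := fun w => by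
    rw [h w, Matrix.one_mulVec]
  obtain ⟨l, hl⟩ := PolyMap.exists_isReducedWord hF
  cases l with
  | some k =>
    have hlab : ∀ i, hexLabel F i = 2 := by
      intro i
      rw [← hexLabel_one i]
      simp only [hexLabel, hval, PolyMap.dualEval_one]
    have := hl.hexLabel_lt k rfl (k + 1) (by simp)
    rw [hlab, hlab] at this
    exact absurd this (lt_irrefl _)
  | none =>
    cases hl with
    | perm σ =>
      -- The vector `(1, 2)` gives the distinct squares `1, 4, 9`, so it detects every permutation.
      have hσ : ∀ i, ![(1 : ℤ), 2, 1 + 2] (σ i) ^ 2 = ![(1 : ℤ), 2, 1 + 2] i ^ 2 := by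
        intro i
        have := congrFun (hval ![1, 2]) i
        simp only [PolyMap.dualEval, PolyMap.perm, aeval_X] at this
        exact oneAddEps_injective this
      have key : ∀ i j : Fin 3, ![(1 : ℤ), 2, 1 + 2] i ^ 2 = ![(1 : ℤ), 2, 1 + 2] j ^ 2 → i = j := by
        decide
      have : σ = 1 := Equiv.ext fun i => key _ _ (hσ i)
      rw [this, PolyMap.perm_one]

end DualNumbers

/-! ### The isomorphism with `PGL(2, ℤ)` -/

section Isomorphism

open Matrix

theorem Represents.eq_one_or_eq_neg_one_of_units {M : GL (Fin 2) ℤ}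
    (h : Represents 1 (M : Matrix (Fin 2) (Fin 2) ℤ)) : M = 1 ∨ M = -1 :=
  h.eq_one_or_eq_neg_one.imp (fun h => Units.ext h) (fun h => Units.ext h)

theorem exists_matrix_represents (F : nielsenTraceMaps) :
    ∃ M : GL (Fin 2) ℤ, Represents F (M : Matrix (Fin 2) (Fin 2) ℤ) := by
  obtain ⟨l, hl⟩ := PolyMap.exists_isReducedWord F.2
  exact hl.exists_represents

theorem exists_inverse_represents (F : nielsenTraceMaps) :
    ∃ (G : nielsenTraceMaps) (K : GL (Fin 2) ℤ), G * F = 1 ∧ F * G = 1 ∧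
      Represents G (K : Matrix (Fin 2) (Fin 2) ℤ) := by
  obtain ⟨G, h1, h2⟩ := isUnit_iff_exists.1 (isUnit_nielsenTraceMaps F)
  obtain ⟨K, hK⟩ := exists_matrix_represents G
  exact ⟨G, K, h2, h1, hK⟩

theorem Represents.eq_or_eq_neg {F : nielsenTraceMaps} {M N : GL (Fin 2) ℤ}
    (hM : Represents F (M : Matrix (Fin 2) (Fin 2) ℤ))
    (hN : Represents F (N : Matrix (Fin 2) (Fin 2) ℤ)) : M = N ∨ M = -N := by
  obtain ⟨G, K, hG, -, hK⟩ := exists_inverse_represents F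
  have hG' : (G : PolyMap) * F = 1 := congrArg Subtype.val hG
  have h1 := hK.mul hM
  have h2 := hK.mul hN
  rw [hG'] at h1 h2
  have hM' : K * M = 1 ∨ K * M = -1 := Represents.eq_one_or_eq_neg_one_of_units h1
  have hN' : K * N = 1 ∨ K * N = -1 := Represents.eq_one_or_eq_neg_one_of_units h2
  rcases hM' with hM' | hM' <;> rcases hN' with hN' | hN'
  · exact Or.inl (mul_left_cancel (hM'.trans hN'.symm))
  · right
    apply mul_left_cancel (a := K)
    rw [hM', mul_neg, hN', neg_neg]
  · right
    apply mul_left_cancel (a := K)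
    rw [hM', mul_neg, hN']
  · exact Or.inl (mul_left_cancel (hM'.trans hN'.symm))

theorem Represents.injective {F G : nielsenTraceMaps} {M : GL (Fin 2) ℤ}
    (hF : Represents F (M : Matrix (Fin 2) (Fin 2) ℤ))
    (hG : Represents G (M : Matrix (Fin 2) (Fin 2) ℤ)) : F = G := by
  obtain ⟨H, K, h1, h2, hK⟩ := exists_inverse_represents G
  have h3 := hK.mul hG
  have h1' : (H : PolyMap) * G = 1 := congrArg Subtype.val h1
  rw [h1'] at h3
  have h4 : K * M = 1 ∨ K * M = -1 := Represents.eq_one_or_eq_neg_one_of_units h3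
  have h5 : Represents ((H * F : nielsenTraceMaps) : PolyMap) 1 := by
    have h6 := hK.mul hF
    rcases h4 with h4 | h4
    · have h7 : (K : Matrix (Fin 2) (Fin 2) ℤ) * M = 1 := congrArg Units.val h4
      rwa [h7] at h6
    · have h7 : (K : Matrix (Fin 2) (Fin 2) ℤ) * M = -1 := congrArg Units.val h4
      rw [h7] at h6
      simpa using h6.neg
  have h8 : H * F = 1 := Subtype.ext (eq_one_of_represents_one (H * F).2 h5)
  calc F = G * H * F := by rw [h2, one_mul]
    _ = G := by rw [mul_assoc, h8, mul_one]

theorem det_eq_one_or_eq_neg_one (M : GL (Fin 2) ℤ) :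
    (M : Matrix (Fin 2) (Fin 2) ℤ).det = 1 ∨ (M : Matrix (Fin 2) (Fin 2) ℤ).det = -1 :=
  Int.isUnit_iff.1 ((Matrix.isUnit_iff_isUnit_det _).1 M.isUnit)

/-- The matrices that represent some Nielsen trace map. -/
noncomputable def representedMatrices : Subgroup (GL (Fin 2) ℤ) where
  carrier := {M | ∃ F : nielsenTraceMaps, Represents F (M : Matrix (Fin 2) (Fin 2) ℤ)}
  mul_mem' := by
    rintro M N ⟨F, hF⟩ ⟨G, hG⟩
    exact ⟨F * G, hF.mul hG⟩
  one_mem' := ⟨1, represents_one⟩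
  inv_mem' := by
    rintro M ⟨F, hF⟩
    obtain ⟨G, K, hG, -, hK⟩ := exists_inverse_represents F
    have hG' : (G : PolyMap) * F = 1 := congrArg Subtype.val hG
    have h := hK.mul hF
    rw [hG'] at h
    have h4 : K * M = 1 ∨ K * M = -1 := Represents.eq_one_or_eq_neg_one_of_units h
    rcases h4 with h4 | h4
    · rw [← eq_inv_of_mul_eq_one_left h4]
      exact ⟨G, hK⟩
    · have h5 : -K * M = 1 := by rw [neg_mul, h4, neg_neg]
      rw [← eq_inv_of_mul_eq_one_left h5]
      exact ⟨G, hK.neg⟩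

theorem exists_mem_representedMatrices (A : Matrix (Fin 2) (Fin 2) ℤ) (F : PolyMap)
    (hF : F ∈ nielsenTraceMaps) (h : Represents F A) (M : GL (Fin 2) ℤ)
    (hM : (M : Matrix (Fin 2) (Fin 2) ℤ) = A) : M ∈ representedMatrices :=
  ⟨⟨F, hF⟩, by rw [hM]; exact h⟩

theorem represents_swap : Represents (PolyMap.perm (Equiv.swap 0 1)) !![0, 1; 1, 0] := by
  intro w
  funext i
  have h : (PolyMap.perm (Equiv.swap 0 1)).dualEval (dualPoint w) i =
      dualPoint w (Equiv.swap 0 1 i) := by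
    simp [PolyMap.dualEval, PolyMap.perm]
  rw [h]
  refine congrArg oneAddEps ?_
  fin_cases i <;> simp [Matrix.mulVec, dotProduct, Fin.sum_univ_two, Equiv.swap_apply_def]
  ring

theorem represents_swap_fst_trd :
    Represents (PolyMap.perm (Equiv.swap 0 2)) !![1, 1; 0, -1] := by
  intro w
  funext i
  have h : (PolyMap.perm (Equiv.swap 0 2)).dualEval (dualPoint w) i =
      dualPoint w (Equiv.swap 0 2 i) := by
    simp [PolyMap.dualEval, PolyMap.perm]
  rw [h]
  refine congrArg oneAddEps ?_
  fin_cases i <;> simp [Matrix.mulVec, dotProduct, Fin.sum_univ_two, Equiv.swap_apply_def]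

theorem represents_reflection_two : Represents (PolyMap.reflection 2) !![1, 0; 0, -1] := by
  intro w
  rw [← mul_one (PolyMap.reflection 2),
    dualEval_reflection_mul (PolyMap.dualEval_one (dualPoint w))]
  funext i
  refine congrArg oneAddEps ?_
  fin_cases i <;> simp [Function.update, Matrix.mulVec, dotProduct, Fin.sum_univ_two]
  ring

/-- Up to sign, `S` and `T` are `diag(1, -1)` times the matrices of the swaps of the first
coordinate with the second and with the third. Multiplying by `diag(1, -1)` reduces determinant `-1`
to determinant `1`. -/
theorem representedMatrices_eq_top : representedMatrices = ⊤ := by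
  have hSL : ∀ g : SpecialLinearGroup (Fin 2) ℤ,
      SpecialLinearGroup.toGL g ∈ representedMatrices := by
    have hle : (⊤ : Subgroup (SpecialLinearGroup (Fin 2) ℤ)) ≤
        representedMatrices.comap SpecialLinearGroup.toGL := by
      rw [← SpecialLinearGroup.SL2Z_generators, Subgroup.closure_le]
      rintro g (rfl | rfl)
      · refine exists_mem_representedMatrices _ _ (mul_mem
          (reflection_mem_nielsenTraceMaps 2) (perm_mem_nielsenTraceMaps (Equiv.swap 0 1)))
          (represents_reflection_two.mul represents_swap).neg _ ?_
        change (ModularGroup.S : Matrix (Fin 2) (Fin 2) ℤ) = _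
        rw [ModularGroup.coe_S]
        simp
      · refine exists_mem_representedMatrices _ _ (mul_mem
          (reflection_mem_nielsenTraceMaps 2) (perm_mem_nielsenTraceMaps (Equiv.swap 0 2)))
          (represents_reflection_two.mul represents_swap_fst_trd) _ ?_
        change (ModularGroup.T : Matrix (Fin 2) (Fin 2) ℤ) = _
        rw [ModularGroup.coe_T]
        simp
    intro g
    exact hle (Subgroup.mem_top g)
  have hdet : ∀ M : GL (Fin 2) ℤ, (M : Matrix (Fin 2) (Fin 2) ℤ).det = 1 →
      M ∈ representedMatrices := by
    intro M hM
    have h := hSL ⟨M, hM⟩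
    rwa [show SpecialLinearGroup.toGL ⟨M, hM⟩ = M from Units.ext rfl] at h
  rw [eq_top_iff]
  intro M _
  rcases det_eq_one_or_eq_neg_one M with h | h
  · exact hdet M h
  · have hD : GeneralLinearGroup.mk'' !![1, 0; 0, -1] (by simp) ∈ representedMatrices :=
      exists_mem_representedMatrices _ _ (reflection_mem_nielsenTraceMaps 2)
        represents_reflection_two _ rfl
    rw [← Subgroup.mul_mem_cancel_left _ hD]
    apply hdet
    rw [Units.val_mul, det_mul, h]
    change det !![1, 0; 0, -1] * -1 = (1 : ℤ)
    simp

namespace Matrix.ProjGenLinGroup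

theorem mk_eq_mk_iff_eq_or_eq_neg {M N : GL (Fin 2) ℤ} :
    (mk M : ProjGenLinGroup (Fin 2) ℤ) = mk N ↔ M = N ∨ M = -N := by
  rw [mk_eq_mk_iff]
  have h1 : (GeneralLinearGroup.scalar (Fin 2)) (1 : ℤˣ) = 1 := map_one _
  have h2 : (GeneralLinearGroup.scalar (Fin 2)) (-1 : ℤˣ) = -1 := by
    ext i j
    fin_cases i <;> fin_cases j <;> simp [GeneralLinearGroup.scalar]
  constructor
  · rintro ⟨u, rfl⟩
    rcases Int.units_eq_one_or u with rfl | rfl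
    · left; rw [h1, mul_one]
    · right; rw [h2, mul_neg, mul_one, neg_neg]
  · rintro (rfl | rfl)
    · exact ⟨1, by rw [h1, mul_one]⟩
    · exact ⟨-1, by rw [h2, mul_neg, mul_one, neg_neg]⟩

end Matrix.ProjGenLinGroup

/-- The class of the matrices through which a Nielsen trace map acts on the tangent cone. -/
noncomputable def toPGL : nielsenTraceMaps →* ProjGenLinGroup (Fin 2) ℤ where
  toFun F := ProjGenLinGroup.mk (exists_matrix_represents F).choose
  map_one' := by
    rw [← map_one ProjGenLinGroup.mk, ProjGenLinGroup.mk_eq_mk_iff_eq_or_eq_neg]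
    exact Represents.eq_or_eq_neg (exists_matrix_represents 1).choose_spec represents_one
  map_mul' F G := by
    rw [← map_mul ProjGenLinGroup.mk, ProjGenLinGroup.mk_eq_mk_iff_eq_or_eq_neg]
    exact Represents.eq_or_eq_neg (exists_matrix_represents (F * G)).choose_spec
      ((exists_matrix_represents F).choose_spec.mul (exists_matrix_represents G).choose_spec)

theorem toPGL_bijective : Function.Bijective toPGL := by
  constructor
  · intro F G h
    have hF := (exists_matrix_represents F).choose_spec
    have hG := (exists_matrix_represents G).choose_spec
    rcases ProjGenLinGroup.mk_eq_mk_iff_eq_or_eq_neg.1 h with h | h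
    · rw [h] at hF
      exact hF.injective hG
    · rw [h] at hF
      exact Represents.injective (by simpa using hF.neg) hG
  · intro g
    obtain ⟨M, rfl⟩ := ProjGenLinGroup.mk_surjective g
    obtain ⟨F, hF⟩ := representedMatrices_eq_top.ge (Subgroup.mem_top M)
    refine ⟨F, ?_⟩
    exact ProjGenLinGroup.mk_eq_mk_iff_eq_or_eq_neg.2
      (Represents.eq_or_eq_neg (exists_matrix_represents F).choose_spec hF)

/-- The group of Nielsen trace maps is isomorphic to `PGL(2, ℤ)`. -/
noncomputable def nielsenTraceMapsEquiv : nielsenTraceMaps ≃* ProjGenLinGroup (Fin 2) ℤ :=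
  MulEquiv.ofBijective toPGL toPGL_bijective

end Isomorphism

/-! ### Recognizing the groups `C₂ × C₂`, `C₃` and `C_∞` -/

section GroupTheory

variable {Γ : Type*} [Group Γ]

/-- A group generated by two distinct commuting involutions, as listed by its elements. -/
theorem nonempty_mulEquiv_kleinFour {H : Subgroup Γ} {x y : Γ} (hx : x ∈ H) (hy : y ∈ H)
    (hxx : x * x = 1) (hyy : y * y = 1) (hxy : x * y = y * x) (hx1 : x ≠ 1) (hy1 : y ≠ 1)
    (hne : x ≠ y) (hH : ∀ h ∈ H, h = 1 ∨ h = x ∨ h = y ∨ h = x * y) :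
    Nonempty (H ≃* Multiplicative (ZMod 2) × Multiplicative (ZMod 2)) := by
  classical
  have hxyxy : x * y * (x * y) = 1 := by
    rw [mul_assoc, ← mul_assoc y, ← hxy, mul_assoc, hyy, mul_one, hxx]
  have hsq : ∀ h ∈ H, h * h = 1 := by
    intro h hh
    rcases hH h hh with rfl | rfl | rfl | rfl
    · simp
    · exact hxx
    · exact hyy
    · exact hxyxy
  have hxyne : x * y ≠ 1 := by
    intro h
    exact hne (mul_right_cancel (h.trans hyy.symm))
  have hcard : Nat.card H = 4 := by
    have hset : (H : Set Γ) = (({1, x, y, x * y} : Finset Γ) : Set Γ) := by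
      ext h
      simp only [SetLike.mem_coe, Finset.coe_insert, Finset.coe_singleton,
        Set.mem_insert_iff, Set.mem_singleton_iff]
      refine ⟨hH h, ?_⟩
      rintro (rfl | rfl | rfl | rfl)
      exacts [one_mem _, hx, hy, mul_mem hx hy]
    have : Nat.card H = (H : Set Γ).ncard := rfl
    rw [this, hset, Set.ncard_coe_finset, Finset.card_insert_of_notMem,
      Finset.card_insert_of_notMem, Finset.card_insert_of_notMem, Finset.card_singleton]
    · simpa using hx1
    · simp [hne, hy1]
    · simp [hx1.symm, hy1.symm, hxyne.symm]
  have : Nontrivial H := ⟨⟨⟨x, hx⟩, 1, fun h => hx1 (congrArg Subtype.val h)⟩⟩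
  have : IsKleinFour H := by
    refine ⟨hcard, (Monoid.exponent_eq_prime_iff Nat.prime_two).2 fun g hg => ?_⟩
    refine orderOf_eq_prime ?_ hg
    rw [sq]
    exact Subtype.ext (hsq g g.2)
  obtain ⟨e⟩ := IsKleinFour.nonempty_mulEquiv (G₁ := H) (G₂ := Multiplicative (ZMod 2 × ZMod 2))
  exact ⟨e.trans (MulEquiv.prodMultiplicative _ _)⟩

theorem nonempty_mulEquiv_zmod_three {H : Subgroup Γ} {g : Γ} (hg : g ∈ H) (h3 : g ^ 3 = 1)
    (h1 : g ≠ 1) (hH : ∀ h ∈ H, h = 1 ∨ h = g ∨ h = g ^ 2) :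
    Nonempty (H ≃* Multiplicative (ZMod 3)) := by
  have hz : H = Subgroup.zpowers g := by
    refine le_antisymm (fun h hh => ?_) (by simpa using hg)
    rcases hH h hh with rfl | rfl | rfl
    · exact one_mem _
    · exact Subgroup.mem_zpowers h
    · exact pow_mem (Subgroup.mem_zpowers g) 2
  subst hz
  have : Fact (Nat.Prime 3) := ⟨Nat.prime_three⟩
  refine ⟨mulEquivOfCyclicCardEq ?_⟩
  rw [Nat.card_zpowers, orderOf_eq_prime h3 h1]
  simp

/-- A nontrivial group with a homomorphism to `ℝ` that is bounded away from zero off the identity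
is infinite cyclic. -/
theorem nonempty_mulEquiv_int_of_isolated {H : Type*} [Group H] [Nontrivial H]
    (l : H →* Multiplicative ℝ) {ε : ℝ} (hε : 0 < ε)
    (hl : ∀ h, |Multiplicative.toAdd (l h)| < ε → h = 1) :
    Nonempty (H ≃* Multiplicative ℤ) := by
  have hinj : Function.Injective l := by
    rw [injective_iff_map_eq_one]
    intro h hh
    apply hl
    rw [hh]
    simpa using hε
  let A : AddSubgroup ℝ := (MonoidHom.toAdditiveLeft l).range
  have hA : ∀ x, x ∈ A ↔ ∃ h, Multiplicative.toAdd (l h) = x := fun x => Iff.rfl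
  -- A subgroup of `ℝ` with a gap next to zero is cyclic.
  have hdisj : Disjoint (A : Set ℝ) (Set.Ioo 0 ε) := by
    rw [Set.disjoint_left]
    rintro x hx ⟨hx0, hxε⟩
    obtain ⟨h, rfl⟩ := (hA x).1 hx
    have := hl h (by rwa [abs_of_pos hx0])
    rw [this, map_one] at hx0
    simp at hx0
  obtain ⟨b, hb⟩ := AddSubgroup.cyclic_of_isolated_zero hε hdisj
  rw [← AddSubgroup.zmultiples_eq_closure] at hb
  obtain ⟨h₀, hh₀⟩ := (hA b).1 (hb ▸ AddSubgroup.mem_zmultiples b)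
  have hgen : ∀ h, ∃ k : ℤ, h₀ ^ k = h := by
    intro h
    have : Multiplicative.toAdd (l h) ∈ AddSubgroup.zmultiples b := hb ▸ (hA _).2 ⟨h, rfl⟩
    obtain ⟨k, hk⟩ := AddSubgroup.mem_zmultiples_iff.1 this
    refine ⟨k, hinj ?_⟩
    rw [map_zpow]
    apply Multiplicative.toAdd.injective
    rw [toAdd_zpow, hh₀, hk]
  have hb0 : b ≠ 0 := by
    rintro rfl
    obtain ⟨h, hne⟩ := exists_ne (1 : H)
    obtain ⟨k, rfl⟩ := hgen h
    have : h₀ = 1 := hl _ (by rw [hh₀]; simpa using hε)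
    rw [this, one_zpow] at hne
    exact hne rfl
  refine ⟨(MulEquiv.ofBijective (zpowersHom H h₀) ⟨?_, ?_⟩).symm⟩
  · rw [injective_iff_map_eq_one]
    intro k hk
    rw [zpowersHom_apply] at hk
    have h2 := congrArg (fun h => Multiplicative.toAdd (l h)) hk
    simp only [map_zpow, toAdd_zpow, hh₀, map_one, toAdd_one, zsmul_eq_mul, mul_eq_zero,
      Int.cast_eq_zero, hb0, or_false] at h2
    exact h2
  · intro h
    obtain ⟨k, hk⟩ := hgen h
    exact ⟨Multiplicative.ofAdd k, by simpa [zpowersHom_apply] using hk⟩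

theorem not_isOfFinOrder_of_mulEquiv_int {H : Type*} [Group H] (e : H ≃* Multiplicative ℤ) {h : H}
    (hh : h ≠ 1) : ¬ IsOfFinOrder h := by
  rw [← Function.Injective.isOfFinOrder_iff (f := (e : H →* Multiplicative ℤ)) e.injective]
  exact not_isOfFinOrder_of_isMulTorsionFree ((map_ne_one_iff e e.injective).2 hh)

/-- The four possible types of an element and of its centralizer in `PGL(2, ℤ)`. -/
def HasCentralizerType (g : Γ) : Prop :=
  g = 1 ∨
  ((g ^ 2 = 1 ∧ g ≠ 1) ∧ Nonempty
    (Subgroup.centralizer {g} ≃* Multiplicative (ZMod 2) × Multiplicative (ZMod 2))) ∨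
  ((g ^ 3 = 1 ∧ g ≠ 1) ∧ Nonempty (Subgroup.centralizer {g} ≃* Multiplicative (ZMod 3))) ∨
  (¬ IsOfFinOrder g ∧ Nonempty (Subgroup.centralizer {g} ≃* Multiplicative ℤ))

/-- Applied to inner automorphisms, this permits replacing an element by any conjugate. -/
theorem HasCentralizerType.map {Δ : Type*} [Group Δ] {g : Γ} (h : HasCentralizerType g)
    (e : Γ ≃* Δ) : HasCentralizerType (e g) := by
  have hc : Nonempty (Subgroup.centralizer {e g} ≃* Subgroup.centralizer {g}) := by
    have hmap : (Subgroup.centralizer {g}).map (e : Γ →* Δ) = Subgroup.centralizer {e g} := by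
      ext x
      obtain ⟨x, rfl⟩ := e.surjective x
      rw [Subgroup.mem_centralizer_singleton_iff, ← map_mul, ← map_mul, e.injective.eq_iff,
        ← Subgroup.mem_centralizer_singleton_iff]
      exact Subgroup.mem_map_iff_mem e.injective
    rw [← hmap]
    exact ⟨(e.subgroupMap _).symm⟩
  obtain ⟨c⟩ := hc
  have h1 : e g = 1 ↔ g = 1 := map_eq_one_iff e e.injective
  have hp : ∀ n : ℕ, e g ^ n = 1 ↔ g ^ n = 1 := fun n => by
    rw [← map_pow, map_eq_one_iff e e.injective]
  have hf : IsOfFinOrder (e g) ↔ IsOfFinOrder g :=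
    Function.Injective.isOfFinOrder_iff (f := (e : Γ →* Δ)) e.injective
  rw [HasCentralizerType, Ne, h1, hp, hp, hf]
  rcases h with h | ⟨h, ⟨f⟩⟩ | ⟨h, ⟨f⟩⟩ | ⟨h, ⟨f⟩⟩
  · exact Or.inl h
  · exact Or.inr (Or.inl ⟨h, ⟨c.trans f⟩⟩)
  · exact Or.inr (Or.inr (Or.inl ⟨h, ⟨c.trans f⟩⟩))
  · exact Or.inr (Or.inr (Or.inr ⟨h, ⟨c.trans f⟩⟩))

theorem HasCentralizerType.of_isConj {g h : Γ} (hg : HasCentralizerType g) (hc : IsConj g h) :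
    HasCentralizerType h := by
  obtain ⟨c, rfl⟩ := isConj_iff.1 hc
  exact hg.map (MulAut.conj c)

end GroupTheory

/-! ### Commuting matrices and parabolic elements -/

section Matrices

open Matrix

theorem GL_two_ext {M N : GL (Fin 2) ℤ} (h00 : M 0 0 = N 0 0) (h01 : M 0 1 = N 0 1)
    (h10 : M 1 0 = N 1 0) (h11 : M 1 1 = N 1 1) : M = N := by
  ext i j
  fin_cases i <;> fin_cases j <;> assumption

theorem GL_two_mul_apply (M N : GL (Fin 2) ℤ) (i j : Fin 2) :
    (M * N) i j = M i 0 * N 0 j + M i 1 * N 1 j := by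
  rw [Units.val_mul, Matrix.mul_apply, Fin.sum_univ_two]

theorem GL_two_neg_apply (M : GL (Fin 2) ℤ) (i j : Fin 2) : (-M) i j = - M i j := rfl

theorem GL_two_eq_one_iff {M : GL (Fin 2) ℤ} :
    M = 1 ↔ M 0 0 = 1 ∧ M 0 1 = 0 ∧ M 1 0 = 0 ∧ M 1 1 = 1 := by
  refine ⟨?_, fun ⟨h1, h2, h3, h4⟩ => GL_two_ext h1 h2 h3 h4⟩
  rintro rfl
  simp

theorem GL_two_eq_neg_one_iff {M : GL (Fin 2) ℤ} :
    M = -1 ↔ M 0 0 = -1 ∧ M 0 1 = 0 ∧ M 1 0 = 0 ∧ M 1 1 = -1 := by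
  refine ⟨?_, fun ⟨h1, h2, h3, h4⟩ => GL_two_ext h1 h2 h3 h4⟩
  rintro rfl
  simp [GL_two_neg_apply]

theorem GL_two_det (M : GL (Fin 2) ℤ) :
    M 0 0 * M 1 1 - M 0 1 * M 1 0 = 1 ∨ M 0 0 * M 1 1 - M 0 1 * M 1 0 = -1 := by
  rw [← Matrix.det_fin_two]
  exact det_eq_one_or_eq_neg_one M

/-- Commuting two-by-two matrices have parallel traceless parts; these are the vanishing minors. -/
theorem GL_two_commute {M N : GL (Fin 2) ℤ} (h : N * M = M * N) :
    N 0 1 * M 1 0 = M 0 1 * N 1 0 ∧ N 0 1 * (M 0 0 - M 1 1) = M 0 1 * (N 0 0 - N 1 1) ∧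
      N 1 0 * (M 0 0 - M 1 1) = M 1 0 * (N 0 0 - N 1 1) := by
  have key : ∀ i j, (N * M) i j = (M * N) i j := fun i j => by rw [h]
  have h00 := key 0 0
  have h01 := key 0 1
  have h10 := key 1 0
  simp only [GL_two_mul_apply] at h00 h01 h10
  refine ⟨?_, ?_, ?_⟩ <;> linarith

/-- Elements commuting with the class of a matrix of nonzero trace lift to commuting matrices. -/
theorem commute_of_mk_commute {M N : GL (Fin 2) ℤ} (ht : M 0 0 + M 1 1 ≠ 0)
    (h : ProjGenLinGroup.mk N * ProjGenLinGroup.mk M =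
      ProjGenLinGroup.mk M * ProjGenLinGroup.mk N) : N * M = M * N := by
  rw [← map_mul, ← map_mul, ProjGenLinGroup.mk_eq_mk_iff_eq_or_eq_neg] at h
  rcases h with h | h
  · exact h
  · exfalso
    apply ht
    -- A lift that only anticommutes would conjugate `M` to `-M`, forcing trace zero.
    have h1 : N * M * N⁻¹ = -M := by rw [h, neg_mul, mul_inv_cancel_right]
    have h2 := congrArg (fun A : GL (Fin 2) ℤ => (A : Matrix (Fin 2) (Fin 2) ℤ).trace) h1
    simp only [Units.val_mul, Units.val_neg, Matrix.trace_units_conj, Matrix.trace_neg,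
      Matrix.trace_fin_two] at h2
    linarith

theorem mk_eq_one_iff {M : GL (Fin 2) ℤ} :
    (ProjGenLinGroup.mk M : ProjGenLinGroup (Fin 2) ℤ) = 1 ↔ M = 1 ∨ M = -1 := by
  rw [← map_one ProjGenLinGroup.mk, ProjGenLinGroup.mk_eq_mk_iff_eq_or_eq_neg]

theorem mk_neg (M : GL (Fin 2) ℤ) :
    (ProjGenLinGroup.mk (-M) : ProjGenLinGroup (Fin 2) ℤ) = ProjGenLinGroup.mk M :=
  ProjGenLinGroup.mk_eq_mk_iff_eq_or_eq_neg.2 (Or.inr rfl)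

/-- If a logarithm-like function is additive on the centralizer of `M` and bounded away from zero
off `±1`, then the class of `M` has infinite cyclic centralizer. -/
theorem hasCentralizerType_of_isolated {M : GL (Fin 2) ℤ} (ht : M 0 0 + M 1 1 ≠ 0)
    (hM : ¬ (M = 1 ∨ M = -1)) (l : GL (Fin 2) ℤ → ℝ) (hneg : ∀ N, l (-N) = l N)
    (hmul : ∀ N N', N * M = M * N → N' * M = M * N' → l (N * N') = l N + l N')
    {ε : ℝ} (hε : 0 < ε) (hl : ∀ N, N * M = M * N → |l N| < ε → N = 1 ∨ N = -1) :
    HasCentralizerType (ProjGenLinGroup.mk M) := by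
  let Z := Subgroup.centralizer {(ProjGenLinGroup.mk M : ProjGenLinGroup (Fin 2) ℤ)}
  have hex : ∀ h : Z, ∃ N, N * M = M * N ∧ ProjGenLinGroup.mk N = (h : ProjGenLinGroup _ _) := by
    rintro ⟨h, hh⟩
    obtain ⟨N, rfl⟩ := ProjGenLinGroup.mk_surjective h
    exact ⟨N, commute_of_mk_commute ht (Subgroup.mem_centralizer_singleton_iff.1 hh), rfl⟩
  choose r hr hmk using hex
  -- Lifts are unique up to sign and `l` is even, so the chosen lifts `r` do not matter.
  have hwell : ∀ N N', (ProjGenLinGroup.mk N : ProjGenLinGroup (Fin 2) ℤ) =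
      ProjGenLinGroup.mk N' → l N = l N' := by
    intro N N' h
    rcases ProjGenLinGroup.mk_eq_mk_iff_eq_or_eq_neg.1 h with rfl | rfl
    · rfl
    · exact hneg N'
  let φ : Z →* Multiplicative ℝ := MonoidHom.mk' (fun h => Multiplicative.ofAdd (l (r h))) (by
    intro h h'
    rw [← ofAdd_add, ← hmul _ _ (hr h) (hr h')]
    refine congrArg Multiplicative.ofAdd (hwell _ _ ?_)
    rw [map_mul, hmk, hmk, hmk]
    rfl)
  have hM1 : (ProjGenLinGroup.mk M : ProjGenLinGroup (Fin 2) ℤ) ≠ 1 := by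
    rwa [Ne, mk_eq_one_iff]
  let m : Z := ⟨ProjGenLinGroup.mk M, Subgroup.mem_centralizer_singleton_iff.2 rfl⟩
  have hm : m ≠ 1 := fun h => hM1 (congrArg Subtype.val h)
  have : Nontrivial Z := ⟨⟨m, 1, hm⟩⟩
  obtain ⟨e⟩ := nonempty_mulEquiv_int_of_isolated φ hε (by
    intro h hh
    have := hl (r h) (hr h) hh
    rw [← mk_eq_one_iff, hmk] at this
    exact Subtype.ext this)
  refine Or.inr (Or.inr (Or.inr ⟨?_, ⟨e⟩⟩))
  have := not_isOfFinOrder_of_mulEquiv_int e hm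
  rwa [← Function.Injective.isOfFinOrder_iff (f := Z.subtype) Z.subtype_injective] at this

/-- The centralizer consists of the matrices `±(1, q; 0, 1)`. The product `N 0 0 * N 0 1` recovers
`q` whatever the sign; it is additive and integral, so `ε = 1` serves as gap. -/
theorem hasCentralizerType_parabolic {M : GL (Fin 2) ℤ} (h10 : M 1 0 = 0) (h01 : M 0 1 ≠ 0)
    (hd : M 0 0 = M 1 1) : HasCentralizerType (ProjGenLinGroup.mk M) := by
  have hcomm : ∀ N, N * M = M * N → N 1 0 = 0 ∧ N 0 0 = N 1 1 ∧ (N 0 0 = 1 ∨ N 0 0 = -1) := by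
    intro N hN
    obtain ⟨h1, h2, -⟩ := GL_two_commute hN
    have hr : N 1 0 = 0 := by
      rw [h10, mul_zero] at h1
      exact (mul_eq_zero.1 h1.symm).resolve_left h01
    have hs : N 0 0 = N 1 1 := by
      rw [hd, sub_self, mul_zero] at h2
      exact sub_eq_zero.1 ((mul_eq_zero.1 h2.symm).resolve_left h01)
    refine ⟨hr, hs, ?_⟩
    have := GL_two_det N
    rw [hr, hs, mul_zero, sub_zero] at this
    rw [hs]
    rcases this with h | h
    · exact mul_self_eq_one_iff.1 h
    · nlinarith
  have hM11 : M 1 1 ≠ 0 := by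
    intro h
    have := GL_two_det M
    simp [h, h10] at this
  refine hasCentralizerType_of_isolated (by rw [hd]; omega) ?_
    (fun N => ((N 0 0 * N 0 1 : ℤ) : ℝ)) ?_ ?_ one_pos ?_
  · rw [GL_two_eq_one_iff, GL_two_eq_neg_one_iff]
    tauto
  · intro N
    simp [GL_two_neg_apply]
  · intro N N' hN hN'
    obtain ⟨h1, h2, h3⟩ := hcomm N hN
    obtain ⟨h1', h2', h3'⟩ := hcomm N' hN'
    rw [← Int.cast_add, Int.cast_inj]
    simp only [GL_two_mul_apply, h1', ← h2']
    rcases h3 with h3 | h3 <;> rcases h3' with h3' | h3' <;> rw [h3, h3'] <;> ring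
  · intro N hN h
    obtain ⟨h1, h2, h3⟩ := hcomm N hN
    have h4 : |N 0 0 * N 0 1| < 1 := by exact_mod_cast h
    rw [Int.abs_lt_one_iff] at h4
    rw [GL_two_eq_one_iff, GL_two_eq_neg_one_iff, ← h2, h1]
    rcases h3 with h3 | h3 <;> rw [h3] at h4 ⊢ <;> simp_all

end Matrices

/-! ### Hyperbolic elements and real quadratic units -/

section Hyperbolic

open Matrix

/-- The value lies strictly between the squares of `|t| - 1` and `|t|`. -/
theorem not_isSquare_sq_sub_four {t : ℤ} (ht : 3 ≤ |t|) : ¬ IsSquare (t ^ 2 - 4) := by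
  rintro ⟨s, hs⟩
  rw [← sq_abs t, ← abs_mul_abs_self s] at hs
  have h0 := abs_nonneg s
  rcases le_or_gt |t| |s| with h | h
  · nlinarith
  · have : |s| ≤ |t| - 1 := by omega
    nlinarith

/-- The value lies strictly between the squares of `|t|` and `|t| + 2`, and differs from that of
`|t| + 1` by parity. -/
theorem not_isSquare_sq_add_four {t : ℤ} (ht : t ≠ 0) : ¬ IsSquare (t ^ 2 + 4) := by
  rintro ⟨s, hs⟩
  rw [← sq_abs t, ← abs_mul_abs_self s] at hs
  have h0 := abs_nonneg s
  have h1 : 1 ≤ |t| := Int.one_le_abs ht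
  rcases le_or_gt |s| |t| with h | h
  · nlinarith
  · rcases (show |s| = |t| + 1 ∨ |t| + 2 ≤ |s| by omega) with h2 | h2
    · rw [h2] at hs
      ring_nf at hs
      omega
    · nlinarith

/-- `1` and a quadratic surd are linearly independent over the integers. -/
theorem eq_zero_of_add_mul_sqrt_eq_zero {D : ℤ} (hD : 0 ≤ D) (hsq : ¬ IsSquare D) {m n : ℤ}
    (h : (m : ℝ) + n * √(D : ℝ) = 0) : n = 0 := by
  by_contra hn
  apply hsq
  have h1 : (n : ℝ) ^ 2 * D = m ^ 2 := by
    have h2 := Real.sq_sqrt (show (0 : ℝ) ≤ D by exact_mod_cast hD)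
    rw [← h2]
    linear_combination (n * √(D : ℝ) - m) * h
  have h3 : n ^ 2 * D = m ^ 2 := by exact_mod_cast h1
  obtain ⟨k, rfl⟩ := (Int.pow_dvd_pow_iff two_ne_zero).1 (Dvd.intro _ h3)
  refine ⟨k, ?_⟩
  have h4 : n ^ 2 ≠ 0 := pow_ne_zero 2 hn
  apply mul_left_cancel₀ h4
  rw [h3]
  ring

/-- A real unit of trace `τ` and norm `±1` close to `±1` is `±1`. -/
theorem eq_one_or_eq_neg_one_of_abs_log_lt {x : ℝ} {τ δ : ℤ} (hδ : δ = 1 ∨ δ = -1)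
    (hx : x ^ 2 - τ * x + δ = 0) (hlog : |Real.log (|x|)| < Real.log (3 / 2)) :
    x = 1 ∨ x = -1 := by
  have hx0 : x ≠ 0 := by
    rintro rfl
    rcases hδ with rfl | rfl <;> norm_num at hx
  have hpos : 0 < |x| := abs_pos.2 hx0
  obtain ⟨h1, h2⟩ := abs_lt.1 hlog
  have hlt : |x| < 3 / 2 := (Real.log_lt_log_iff hpos (by norm_num)).1 h2
  have hgt : 2 / 3 < |x| := by
    rw [← Real.log_inv] at h1
    have := (Real.log_lt_log_iff (by norm_num) hpos).1 h1
    norm_num at this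
    exact this
  have hsq : |x| ^ 2 = x ^ 2 := sq_abs x
  have habs : |(τ : ℝ)| * |x| = |x ^ 2 + δ| := by
    rw [← abs_mul]
    congr 1
    linarith
  -- For `2/3 < |x| < 3/2`, norm `1` gives `|τ| = |x| + 1/|x|` in `[2, 3)`, so `|τ| = 2`; norm `-1`
  -- gives `|τ| = ||x| - 1/|x|| < 1`, so `τ = 0`.
  rcases hδ with rfl | rfl
  · have hτ : |(τ : ℝ)| < 3 := by
      have h3 : |x ^ 2 + ((1 : ℤ) : ℝ)| = |x| ^ 2 + 1 := by
        rw [hsq, Int.cast_one]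
        exact abs_of_pos (by positivity)
      rw [h3] at habs
      by_contra hcon
      push Not at hcon
      nlinarith
    have hτ' : 2 ≤ |(τ : ℝ)| := by
      have h3 : |x ^ 2 + ((1 : ℤ) : ℝ)| = |x| ^ 2 + 1 := by
        rw [hsq, Int.cast_one]
        exact abs_of_pos (by positivity)
      rw [h3] at habs
      by_contra hcon
      push Not at hcon
      nlinarith [sq_nonneg (|x| - 1)]
    have h4 : |τ| < 3 := by exact_mod_cast hτ
    have h5 : 2 ≤ |τ| := by exact_mod_cast hτ'
    have h6 : |τ| = 2 := by omega
    rcases (abs_eq (by norm_num)).1 h6 with rfl | rfl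
    · left
      have : (x - 1) ^ 2 = 0 := by push_cast at hx; linarith
      have := pow_eq_zero_iff two_ne_zero |>.1 this
      linarith
    · right
      have : (x + 1) ^ 2 = 0 := by push_cast at hx; linarith
      have := pow_eq_zero_iff two_ne_zero |>.1 this
      linarith
  · have hτ : |(τ : ℝ)| < 1 := by
      have h3 : |x ^ 2 + ((-1 : ℤ) : ℝ)| < |x| := by
        push_cast
        rw [← hsq, abs_lt]
        constructor <;> nlinarith
      rw [← habs] at h3
      by_contra hcon
      push Not at hcon
      nlinarith
    have h4 : |τ| < 1 := by exact_mod_cast hτ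
    rw [Int.abs_lt_one_iff] at h4
    subst h4
    have : x ^ 2 = 1 ^ 2 := by push_cast at hx; linarith
    exact sq_eq_sq_iff_eq_or_eq_neg.1 this

/-- With `θ` irrational and `(1, θ)` an eigenvector of `M`, every commuting `N` shares it, with
eigenvalue `N 0 0 + N 0 1 * θ`. This eigenvalue is multiplicative, determines `N`, and is a unit, so
the logarithm of its absolute value has a gap at zero. -/
theorem hasCentralizerType_hyperbolic {M : GL (Fin 2) ℤ} (ht : M 0 0 + M 1 1 ≠ 0)
    (hD : 0 ≤ (M 0 0 - M 1 1) ^ 2 + 4 * M 0 1 * M 1 0)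
    (hsq : ¬ IsSquare ((M 0 0 - M 1 1) ^ 2 + 4 * M 0 1 * M 1 0)) :
    HasCentralizerType (ProjGenLinGroup.mk M) := by
  have hb : M 0 1 ≠ 0 := by
    intro h
    rw [h] at hsq
    exact hsq ⟨M 0 0 - M 1 1, by ring⟩
  have hbR : ((M 0 1 : ℤ) : ℝ) ≠ 0 := by exact_mod_cast hb
  set D := (M 0 0 - M 1 1) ^ 2 + 4 * M 0 1 * M 1 0 with hDdef
  obtain ⟨θ, hθ⟩ : ∃ θ : ℝ, θ = (((M 1 1 - M 0 0 : ℤ) : ℝ) + √(D : ℝ)) / (2 * (M 0 1 : ℤ)) :=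
    ⟨_, rfl⟩
  have hθ' : 2 * (M 0 1 : ℤ) * θ = ((M 1 1 - M 0 0 : ℤ) : ℝ) + √(D : ℝ) := by
    rw [hθ]
    field_simp
  have hquad : ((M 0 1 : ℤ) : ℝ) * θ ^ 2 + ((M 0 0 - M 1 1 : ℤ) : ℝ) * θ - (M 1 0 : ℤ) = 0 := by
    have h2 := Real.sq_sqrt (show (0 : ℝ) ≤ D by exact_mod_cast hD)
    have h3 : √(D : ℝ) = 2 * (M 0 1 : ℤ) * θ + ((M 0 0 - M 1 1 : ℤ) : ℝ) := by
      rw [hθ']; push_cast; ring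
    rw [h3, hDdef] at h2
    push_cast at h2 ⊢
    have h4 : 4 * ((M 0 1 : ℤ) : ℝ) * (((M 0 1 : ℤ) : ℝ) * θ ^ 2 +
      (((M 0 0 : ℤ) : ℝ) - (M 1 1 : ℤ)) * θ - (M 1 0 : ℤ)) = 0 := by linear_combination h2
    exact (mul_eq_zero.1 h4).resolve_left (mul_ne_zero four_ne_zero hbR)
  have hindep : ∀ p q : ℤ, (p : ℝ) + q * θ = 0 → p = 0 ∧ q = 0 := by
    intro p q h
    have h1 : ((2 * M 0 1 * p + q * (M 1 1 - M 0 0) : ℤ) : ℝ) + q * √(D : ℝ) = 0 := by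
      push_cast at hθ' ⊢
      linear_combination 2 * ((M 0 1 : ℤ) : ℝ) * h - q * hθ'
    have hq := eq_zero_of_add_mul_sqrt_eq_zero hD hsq h1
    subst hq
    simp at h
    exact ⟨h, rfl⟩
  have hN : ∀ N : GL (Fin 2) ℤ, N * M = M * N →
      ((N 0 1 : ℤ) : ℝ) * θ ^ 2 + ((N 0 0 - N 1 1 : ℤ) : ℝ) * θ - (N 1 0 : ℤ) = 0 := by
    intro N h
    obtain ⟨h1, h2, -⟩ := GL_two_commute h
    have h1' : ((N 0 1 : ℤ) : ℝ) * (M 1 0 : ℤ) = (M 0 1 : ℤ) * (N 1 0 : ℤ) := by exact_mod_cast h1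
    have h2' : ((N 0 1 : ℤ) : ℝ) * ((M 0 0 - M 1 1 : ℤ) : ℝ) =
      (M 0 1 : ℤ) * ((N 0 0 - N 1 1 : ℤ) : ℝ) := by exact_mod_cast h2
    apply mul_left_cancel₀ hbR
    linear_combination ((N 0 1 : ℤ) : ℝ) * hquad + h1' - θ * h2'
  have hne : ∀ N : GL (Fin 2) ℤ, ((N 0 0 : ℤ) : ℝ) + (N 0 1 : ℤ) * θ ≠ 0 := by
    intro N h
    obtain ⟨h1, h2⟩ := hindep _ _ h
    have := GL_two_det N
    simp [h1, h2] at this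
  refine hasCentralizerType_of_isolated ht ?_
    (fun N => Real.log |((N 0 0 : ℤ) : ℝ) + (N 0 1 : ℤ) * θ|) ?_ ?_
    (Real.log_pos (show (1 : ℝ) < 3 / 2 by norm_num)) ?_
  · rw [GL_two_eq_one_iff, GL_two_eq_neg_one_iff]
    tauto
  · intro N
    simp only [GL_two_neg_apply]
    rw [← abs_neg]
    push_cast
    congr 2
    ring
  · intro N N' h h'
    rw [← Real.log_mul (abs_ne_zero.2 (hne N)) (abs_ne_zero.2 (hne N')), ← abs_mul]
    congr 2
    simp only [GL_two_mul_apply]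
    have := hN N' h'
    push_cast at this ⊢
    linear_combination -((N 0 1 : ℤ) : ℝ) * this
  · intro N h hlog
    have hx : (((N 0 0 : ℤ) : ℝ) + (N 0 1 : ℤ) * θ) ^ 2 -
        ((N 0 0 + N 1 1 : ℤ) : ℝ) * (((N 0 0 : ℤ) : ℝ) + (N 0 1 : ℤ) * θ) +
        ((N 0 0 * N 1 1 - N 0 1 * N 1 0 : ℤ) : ℝ) = 0 := by
      have := hN N h
      push_cast at this ⊢
      linear_combination ((N 0 1 : ℤ) : ℝ) * this
    have hcases := eq_one_or_eq_neg_one_of_abs_log_lt (GL_two_det N) hx hlog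
    have hN' := hN N h
    rw [GL_two_eq_one_iff, GL_two_eq_neg_one_iff]
    have hfin : ∀ s : ℤ, ((N 0 0 : ℤ) : ℝ) + (N 0 1 : ℤ) * θ = s →
        N 0 0 = s ∧ N 0 1 = 0 ∧ N 1 0 = 0 ∧ N 1 1 = s := by
      intro s hs
      obtain ⟨h1, h2⟩ := hindep (N 0 0 - s) (N 0 1) (by push_cast; linarith)
      rw [h2] at hN'
      obtain ⟨h3, h4⟩ := hindep (-N 1 0) (N 0 0 - N 1 1) (by push_cast at hN' ⊢; linarith)
      omega
    rcases hcases with h1 | h1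
    · exact Or.inl (hfin 1 (by simpa using h1))
    · exact Or.inr (hfin (-1) (by simpa using h1))

end Hyperbolic

/-! ### Reduction of matrices of small discriminant -/

section Reduction

open Matrix

/-- The shear `(u, v) ↦ (u + k v, v)`. -/
def shear (k : ℤ) : GL (Fin 2) ℤ :=
  ⟨!![1, k; 0, 1], !![1, -k; 0, 1], by simp [Matrix.one_fin_two], by simp [Matrix.one_fin_two]⟩

/-- The matrix exchanging the two coordinates. -/
def swapGL : GL (Fin 2) ℤ :=
  ⟨!![0, 1; 1, 0], !![0, 1; 1, 0], by simp [Matrix.one_fin_two], by simp [Matrix.one_fin_two]⟩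

/-- The matrix changing the sign of the second coordinate. -/
def diagGL : GL (Fin 2) ℤ :=
  ⟨!![1, 0; 0, -1], !![1, 0; 0, -1], by simp [Matrix.one_fin_two], by simp [Matrix.one_fin_two]⟩

theorem shear_apply (k : ℤ) (i j : Fin 2) : shear k i j = !![1, k; 0, 1] i j := rfl

theorem shear_inv_apply (k : ℤ) (i j : Fin 2) : (shear k)⁻¹ i j = !![1, -k; 0, 1] i j := rfl

theorem swapGL_apply (i j : Fin 2) : swapGL i j = !![0, 1; 1, 0] i j := rfl

theorem swapGL_inv : swapGL⁻¹ = swapGL := rfl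

theorem diagGL_apply (i j : Fin 2) : diagGL i j = !![1, 0; 0, -1] i j := rfl

theorem isConj_conj {Γ : Type*} [Group Γ] (g h : Γ) : IsConj h (g * h * g⁻¹) :=
  isConj_iff.2 ⟨g, rfl⟩

theorem shear_conj_apply (k : ℤ) (M : GL (Fin 2) ℤ) :
    (shear k * M * (shear k)⁻¹) 0 0 = M 0 0 + k * M 1 0 ∧
    (shear k * M * (shear k)⁻¹) 0 1 = M 0 1 + k * M 1 1 - k * (M 0 0 + k * M 1 0) ∧
    (shear k * M * (shear k)⁻¹) 1 0 = M 1 0 ∧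
    (shear k * M * (shear k)⁻¹) 1 1 = M 1 1 - k * M 1 0 := by
  refine ⟨?_, ?_, ?_, ?_⟩ <;>
    simp [GL_two_mul_apply, shear_apply, shear_inv_apply] <;> ring

theorem swap_conj_apply (M : GL (Fin 2) ℤ) :
    (swapGL * M * swapGL⁻¹) 0 0 = M 1 1 ∧ (swapGL * M * swapGL⁻¹) 0 1 = M 1 0 ∧
    (swapGL * M * swapGL⁻¹) 1 0 = M 0 1 ∧ (swapGL * M * swapGL⁻¹) 1 1 = M 0 0 := by
  refine ⟨?_, ?_, ?_, ?_⟩ <;>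
    simp [GL_two_mul_apply, swapGL_inv, swapGL_apply]

/-- Centred remainder modulo `2 * |c|`. Conjugation by `shear k` shifts the difference of the
diagonal entries by `2 * k * c`, where `c` is the lower left entry. -/
theorem exists_abs_add_two_mul_le (x : ℤ) {c : ℤ} (hc : c ≠ 0) :
    ∃ k : ℤ, |x + 2 * k * c| ≤ |c| := by
  have hpos : 0 < 2 * |c| := by positivity
  obtain ⟨s, hs⟩ : ∃ s : ℤ, |c| = s * c := by
    rcases abs_choice c with h | h
    · exact ⟨1, by rw [h, one_mul]⟩
    · exact ⟨-1, by rw [h, neg_one_mul]⟩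
  have h1 := Int.emod_add_mul_ediv (x + |c|) (2 * |c|)
  have h2 := Int.emod_nonneg (x + |c|) hpos.ne'
  have h3 := Int.emod_lt_of_pos (x + |c|) hpos
  refine ⟨-(s * ((x + |c|) / (2 * |c|))), ?_⟩
  have h4 : x + 2 * -(s * ((x + |c|) / (2 * |c|))) * c = (x + |c|) % (2 * |c|) - |c| := by
    have : 2 * -(s * ((x + |c|) / (2 * |c|))) * c =
        -(2 * (s * c) * ((x + |c|) / (2 * |c|))) := by ring
    rw [← hs] at this
    rw [this]
    linarith
  rw [h4, abs_le]
  constructor <;> linarith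

/-- Reduction of integral matrices of small discriminant. -/
theorem exists_isConj_reduced (M : GL (Fin 2) ℤ)
    (hM : |(M 0 0 - M 1 1) ^ 2 + 4 * M 0 1 * M 1 0| ≤ 4) :
    ∃ N : GL (Fin 2) ℤ, IsConj N M ∧ (N 1 0 = 0 ∨ (|N 1 0| = 1 ∧ |N 0 0 - N 1 1| ≤ 1)) ∧
      N 0 0 + N 1 1 = M 0 0 + M 1 1 ∧
      (N 0 0 - N 1 1) ^ 2 + 4 * N 0 1 * N 1 0 = (M 0 0 - M 1 1) ^ 2 + 4 * M 0 1 * M 1 0 := by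
  induction hn : (M 1 0).natAbs using Nat.strong_induction_on generalizing M with
  | _ n ih =>
  subst hn
  by_cases hc : M 1 0 = 0
  · exact ⟨M, IsConj.refl M, Or.inl hc, rfl, rfl⟩
  obtain ⟨k, hk⟩ := exists_abs_add_two_mul_le (M 0 0 - M 1 1) hc
  obtain ⟨h00, h01, h10, h11⟩ := shear_conj_apply k M
  have hconj := isConj_conj (shear k) M
  generalize shear k * M * (shear k)⁻¹ = N at h00 h01 h10 h11 hconj
  have htr : N 0 0 + N 1 1 = M 0 0 + M 1 1 := by rw [h00, h11]; ring
  have hdisc : (N 0 0 - N 1 1) ^ 2 + 4 * N 0 1 * N 1 0 =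
      (M 0 0 - M 1 1) ^ 2 + 4 * M 0 1 * M 1 0 := by
    rw [h00, h01, h10, h11]; ring
  have hdiff : |N 0 0 - N 1 1| ≤ |N 1 0| := by
    rw [h00, h11, h10]
    convert hk using 2
    ring
  rw [← h10] at hc ih
  rw [← hdisc] at hM ⊢
  rw [← htr]
  -- If the upper right entry `b` is smaller than the lower left entry `c`, exchange them and
  -- recurse. Otherwise `4c² ≤ 4|bc| ≤ 4 + c²`, which forces `|c| = 1`.
  rcases lt_or_ge (N 0 1).natAbs (N 1 0).natAbs with hlt | hge
  · obtain ⟨g00, g01, g10, g11⟩ := swap_conj_apply N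
    have gconj := isConj_conj swapGL N
    generalize swapGL * N * swapGL⁻¹ = P at g00 g01 g10 g11 gconj
    have hP : (P 0 0 - P 1 1) ^ 2 + 4 * P 0 1 * P 1 0 =
        (N 0 0 - N 1 1) ^ 2 + 4 * N 0 1 * N 1 0 := by
      rw [g00, g01, g10, g11]; ring
    obtain ⟨Q, hQ, hQ', htr', hdisc'⟩ := ih _ (by rw [g10]; exact hlt) P (by rw [hP]; exact hM) rfl
    refine ⟨Q, hQ.trans (hconj.trans gconj).symm, hQ', ?_, by rw [hdisc', hP]⟩
    rw [htr', g00, g11, add_comm]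
  · refine ⟨N, hconj.symm, Or.inr ?_, rfl, rfl⟩
    have h1 : |N 1 0| ≤ |N 0 1| := by
      rw [Int.abs_eq_natAbs, Int.abs_eq_natAbs]
      exact_mod_cast hge
    have hc1 : 1 ≤ |N 1 0| := Int.one_le_abs hc
    have h2 : 4 * (|N 0 1| * |N 1 0|) ≤ 4 + |N 1 0| ^ 2 := by
      have h3 : 4 * (|N 0 1| * |N 1 0|) = |4 * N 0 1 * N 1 0| := by
        rw [mul_assoc, abs_mul, abs_mul]; norm_num
      rw [h3]
      have h4 : 4 * N 0 1 * N 1 0 =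
        ((N 0 0 - N 1 1) ^ 2 + 4 * N 0 1 * N 1 0) - (N 0 0 - N 1 1) ^ 2 := by ring
      rw [h4]
      refine (abs_sub _ _).trans (add_le_add hM ?_)
      rw [abs_pow]
      exact pow_le_pow_left₀ (abs_nonneg _) hdiff 2
    have h5 : |N 1 0| = 1 := by nlinarith
    exact ⟨h5, h5 ▸ hdiff⟩

end Reduction

/-! ### Centralizers of elements of order three and two -/

section FiniteOrder

open Matrix

/-- The form is the Eisenstein norm `p² - ps + s²`: positive definite, with six units. -/
theorem eisenstein_units {p s : ℤ} (h : p * s + (p - s) ^ 2 = 1 ∨ p * s + (p - s) ^ 2 = -1) :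
    (p = 1 ∧ s = 0) ∨ (p = -1 ∧ s = 0) ∨ (p = 0 ∧ s = 1) ∨ (p = 0 ∧ s = -1) ∨
      (p = 1 ∧ s = 1) ∨ (p = -1 ∧ s = -1) := by
  have h1 : p * s + (p - s) ^ 2 = 1 := h.resolve_right fun h => by
    nlinarith [sq_nonneg (p - s), sq_nonneg (p + s)]
  have hp : p ^ 2 < 2 ^ 2 := by nlinarith [sq_nonneg (p - 2 * s)]
  have hs : s ^ 2 < 2 ^ 2 := by nlinarith [sq_nonneg (s - 2 * p)]
  obtain ⟨hp1, hp2⟩ := abs_lt.1 (abs_lt_of_sq_lt_sq hp (by norm_num))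
  obtain ⟨hs1, hs2⟩ := abs_lt.1 (abs_lt_of_sq_lt_sq hs (by norm_num))
  interval_cases p <;> interval_cases s <;> simp_all

/-- The six units are `±1`, `±M`, `±M²`. The right sides stay unevaluated so as to match the
expanded entries of these matrices. -/
theorem eisenstein_powers {a e p r s : ℤ}
    (hae : (a = 0 ∧ (e = 1 ∨ e = -1)) ∨ (e = 0 ∧ (a = 1 ∨ a = -1)))
    (hps : (p = 1 ∧ s = 0) ∨ (p = -1 ∧ s = 0) ∨ (p = 0 ∧ s = 1) ∨ (p = 0 ∧ s = -1) ∨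
      (p = 1 ∧ s = 1) ∨ (p = -1 ∧ s = -1)) (hr : r * (a - e) = p - s) :
    ((p = 1 ∧ -r = 0 ∧ r = 0 ∧ s = 1) ∨ (p = -1 ∧ -r = 0 ∧ r = 0 ∧ s = -1)) ∨
    ((p = a ∧ -r = -1 ∧ r = 1 ∧ s = e) ∨ (p = -a ∧ -r = - -1 ∧ r = -1 ∧ s = -e)) ∨
    ((p = a * a + -1 * 1 ∧ -r = a * -1 + -1 * e ∧ r = 1 * a + e * 1 ∧ s = 1 * -1 + e * e) ∨
      (p = -(a * a + -1 * 1) ∧ -r = -(a * -1 + -1 * e) ∧ r = -(1 * a + e * 1) ∧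
        s = -(1 * -1 + e * e))) := by
  rcases hae with ⟨rfl, rfl | rfl⟩ | ⟨rfl, rfl | rfl⟩ <;>
  rcases hps with ⟨rfl, rfl⟩ | ⟨rfl, rfl⟩ | ⟨rfl, rfl⟩ | ⟨rfl, rfl⟩ | ⟨rfl, rfl⟩ | ⟨rfl, rfl⟩ <;>
  first
  | (obtain rfl : r = 0 := by omega); decide
  | (obtain rfl : r = 1 := by omega); decide
  | (obtain rfl : r = -1 := by omega); decide

/-- Here `M` has determinant `1` and trace `±1`, so it generates a copy of the Eisenstein integers.
The commuting invertible matrices are its six units, and modulo `±1` three classes remain. -/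
theorem hasCentralizerType_order_three {M : GL (Fin 2) ℤ} (h10 : M 1 0 = 1) (h01 : M 0 1 = -1)
    (had : M 0 0 * M 1 1 = 0) (ht : M 0 0 + M 1 1 = 1 ∨ M 0 0 + M 1 1 = -1) :
    HasCentralizerType (ProjGenLinGroup.mk M) := by
  have hcases : (M 0 0 = 0 ∧ (M 1 1 = 1 ∨ M 1 1 = -1)) ∨
      (M 1 1 = 0 ∧ (M 0 0 = 1 ∨ M 0 0 = -1)) := by
    rcases mul_eq_zero.1 had with h | h <;> rw [h] at ht ⊢ <;> simpa using ht
  have h3 : M ^ 3 = 1 ∨ M ^ 3 = -1 := by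
    rw [pow_succ, sq, GL_two_eq_one_iff, GL_two_eq_neg_one_iff]
    simp only [GL_two_mul_apply, h10, h01]
    rcases hcases with ⟨h, h' | h'⟩ | ⟨h, h' | h'⟩ <;> rw [h, h'] <;> norm_num
  have hne : (ProjGenLinGroup.mk M : ProjGenLinGroup (Fin 2) ℤ) ≠ 1 := by
    rw [Ne, mk_eq_one_iff, GL_two_eq_one_iff, GL_two_eq_neg_one_iff, h10]
    norm_num
  have h3' : (ProjGenLinGroup.mk M : ProjGenLinGroup (Fin 2) ℤ) ^ 3 = 1 := by
    rw [← map_pow, mk_eq_one_iff]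
    exact h3
  refine Or.inr (Or.inr (Or.inl ⟨⟨h3', hne⟩, nonempty_mulEquiv_zmod_three
    (Subgroup.mem_centralizer_singleton_iff.2 rfl) h3' hne ?_⟩))
  intro h hh
  obtain ⟨N, rfl⟩ := ProjGenLinGroup.mk_surjective h
  have hN := commute_of_mk_commute (by omega) (Subgroup.mem_centralizer_singleton_iff.1 hh)
  obtain ⟨h1, -, h2⟩ := GL_two_commute hN
  rw [h10, h01] at h1
  rw [h10, one_mul] at h2
  have hdet := GL_two_det N
  rw [← map_pow, mk_eq_one_iff, ProjGenLinGroup.mk_eq_mk_iff_eq_or_eq_neg,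
    ProjGenLinGroup.mk_eq_mk_iff_eq_or_eq_neg, GL_two_eq_one_iff, GL_two_eq_neg_one_iff]
  have hext : ∀ A : GL (Fin 2) ℤ, N = A ↔
      N 0 0 = A 0 0 ∧ N 0 1 = A 0 1 ∧ N 1 0 = A 1 0 ∧ N 1 1 = A 1 1 :=
    fun A => ⟨fun h => by simp [h], fun ⟨h1, h2, h3, h4⟩ => GL_two_ext h1 h2 h3 h4⟩
  rw [hext M, hext (-M), hext (M ^ 2), hext (-M ^ 2)]
  simp only [GL_two_neg_apply, sq, GL_two_mul_apply, h10, h01]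
  have hq : N 0 1 = - N 1 0 := by linarith
  rw [hq] at hdet ⊢
  have hr : N 1 0 * N 1 0 = (N 0 0 - N 1 1) ^ 2 := by
    rw [← h2]
    rcases hcases with ⟨h, h' | h'⟩ | ⟨h, h' | h'⟩ <;> rw [h, h'] <;> ring
  have hdet' : N 0 0 * N 1 1 + (N 0 0 - N 1 1) ^ 2 = 1 ∨
      N 0 0 * N 1 1 + (N 0 0 - N 1 1) ^ 2 = -1 := by
    rw [← hr]
    refine hdet.imp (fun h => ?_) (fun h => ?_) <;> linarith
  have hunits := eisenstein_units hdet'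
  generalize N 0 0 = p at *
  generalize N 1 0 = r at *
  generalize N 1 1 = s at *
  generalize M 0 0 = a at *
  generalize M 1 1 = e at *
  exact eisenstein_powers hcases hunits h2

theorem swapGL_mul_diagGL_apply (i j : Fin 2) :
    (swapGL * diagGL) i j = !![0, -1; 1, 0] i j := by
  rw [GL_two_mul_apply]
  fin_cases i <;> fin_cases j <;> simp [swapGL_apply, diagGL_apply]

theorem hyperbola_units {p q : ℤ} (h : p * p - q * q = 1 ∨ p * p - q * q = -1) :
    (q = 0 ∧ (p = 1 ∨ p = -1)) ∨ (p = 0 ∧ (q = 1 ∨ q = -1)) := by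
  have h1 : (p - q) * (p + q) = 1 ∨ (p - q) * (p + q) = -1 := by
    refine h.imp (fun h => ?_) (fun h => ?_) <;> linarith
  rcases h1 with h1 | h1
  · rcases Int.mul_eq_one_iff_eq_one_or_neg_one.1 h1 with h2 | h2 <;> omega
  · rcases Int.mul_eq_neg_one_iff_eq_one_or_neg_one.1 h1 with h2 | h2 <;> omega

theorem circle_units {p q : ℤ} (h : p * p + q * q = 1 ∨ p * p + q * q = -1) :
    (q = 0 ∧ (p = 1 ∨ p = -1)) ∨ (p = 0 ∧ (q = 1 ∨ q = -1)) := by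
  by_cases hq : q = 0
  · left
    refine ⟨hq, ?_⟩
    subst hq
    rw [mul_zero, add_zero] at h
    exact mul_self_eq_one_iff.1 (h.resolve_right (by nlinarith))
  · right
    have h1 : 0 < q * q := mul_self_pos.2 hq
    have hp : p * p = 0 := by
      have := mul_self_nonneg p
      omega
    rw [hp, zero_add] at h
    exact ⟨mul_self_eq_zero.1 hp, mul_self_eq_one_iff.1 (h.resolve_right (by omega))⟩

/-- The alternatives cover commuting or anticommuting with `swapGL`, `diagGL` or their product. In
each, the determinant becomes, up to sign, a sum or difference of two squares, or one product. -/
theorem signed_permutation_entries {p q r s : ℤ}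
    (hdet : p * s - q * r = 1 ∨ p * s - q * r = -1)
    (h : (q = r ∧ (p = s ∨ p = -s)) ∨ (q = -r ∧ (p = s ∨ p = -s)) ∨ (q = 0 ∧ r = 0) ∨
      (p = 0 ∧ s = 0)) :
    (q = 0 ∧ r = 0 ∧ (p = 1 ∨ p = -1) ∧ (s = 1 ∨ s = -1)) ∨
      (p = 0 ∧ s = 0 ∧ (q = 1 ∨ q = -1) ∧ (r = 1 ∨ r = -1)) := by
  rcases h with ⟨rfl, rfl | rfl⟩ | ⟨rfl, rfl | rfl⟩ | ⟨rfl, rfl⟩ | ⟨rfl, rfl⟩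
  · have := hyperbola_units hdet
    omega
  · have := circle_units (p := s) (q := q)
      (hdet.symm.imp (fun h => by linarith) (fun h => by linarith))
    omega
  · have := circle_units (p := p) (q := r)
      (hdet.imp (fun h => by linarith) (fun h => by linarith))
    omega
  · have := hyperbola_units (p := s) (q := r)
      (hdet.symm.imp (fun h => by linarith) (fun h => by linarith))
    omega
  · left
    rw [mul_zero, sub_zero, ← Int.isUnit_iff, IsUnit.mul_iff, Int.isUnit_iff, Int.isUnit_iff]
      at hdet
    exact ⟨rfl, rfl, hdet⟩
  · right
    rw [mul_zero, zero_sub, ← Int.isUnit_iff, IsUnit.neg_iff, IsUnit.mul_iff, Int.isUnit_iff,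
      Int.isUnit_iff] at hdet
    exact ⟨rfl, rfl, hdet⟩

/-- The centralizer of each of the three standard involutions consists of signed permutation
matrices. -/
theorem signed_permutation_of_commute {M N : GL (Fin 2) ℤ}
    (hM : M = swapGL ∨ M = diagGL ∨ M = swapGL * diagGL)
    (h : N * M = M * N ∨ N * M = -(M * N)) :
    (N = 1 ∨ N = -1) ∨ (N = swapGL ∨ N = -swapGL) ∨ (N = diagGL ∨ N = -diagGL) ∨
      (N = swapGL * diagGL ∨ N = -(swapGL * diagGL)) := by
  have hentries := signed_permutation_entries (GL_two_det N) (by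
    have key : (∀ i j, (N * M) i j = (M * N) i j) ∨ (∀ i j, (N * M) i j = -(M * N) i j) := by
      rcases h with h | h
      · exact Or.inl fun i j => by rw [h]
      · exact Or.inr fun i j => by rw [h]; rfl
    clear h
    simp only [GL_two_mul_apply] at key
    rcases hM with rfl | rfl | rfl
    · simp only [swapGL_apply, Fin.forall_fin_two, Matrix.of_apply, Matrix.cons_val_zero,
        Matrix.cons_val_one, mul_zero, mul_one, zero_add, add_zero, zero_mul, one_mul] at key
      omega
    · simp only [diagGL_apply, Fin.forall_fin_two, Matrix.of_apply, Matrix.cons_val_zero,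
        Matrix.cons_val_one, mul_zero, mul_one, zero_add, add_zero, zero_mul, one_mul, mul_neg,
        neg_mul] at key
      omega
    · simp only [swapGL_mul_diagGL_apply, Fin.forall_fin_two, Matrix.of_apply,
        Matrix.cons_val_zero, Matrix.cons_val_one, mul_zero, mul_one, zero_add, add_zero,
        zero_mul, one_mul, mul_neg, neg_mul] at key
      omega)
  have hext : ∀ A : GL (Fin 2) ℤ,
      N 0 0 = A 0 0 → N 0 1 = A 0 1 → N 1 0 = A 1 0 → N 1 1 = A 1 1 → N = A :=
    fun A h1 h2 h3 h4 => GL_two_ext h1 h2 h3 h4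
  rcases hentries with ⟨h1, h2, h3 | h3, h4 | h4⟩ | ⟨h1, h2, h3 | h3, h4 | h4⟩
  · exact Or.inl (Or.inl (hext _ h3 h1 h2 h4))
  · exact Or.inr (Or.inr (Or.inl (Or.inl (hext _ h3 h1 h2 h4))))
  · exact Or.inr (Or.inr (Or.inl (Or.inr (hext _ h3 h1 h2 h4))))
  · exact Or.inl (Or.inr (hext _ h3 h1 h2 h4))
  · exact Or.inr (Or.inl (Or.inl (hext _ h1 h3 h4 h2)))
  · exact Or.inr (Or.inr (Or.inr (Or.inr (hext _ (h1.trans (by simp [GL_two_neg_apply,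
      swapGL_mul_diagGL_apply])) (h3.trans (by simp [GL_two_neg_apply,
      swapGL_mul_diagGL_apply])) (h4.trans (by simp [GL_two_neg_apply,
      swapGL_mul_diagGL_apply])) (h2.trans (by simp [GL_two_neg_apply,
      swapGL_mul_diagGL_apply]))))))
  · exact Or.inr (Or.inr (Or.inr (Or.inl (hext _ (h1.trans (by simp [swapGL_mul_diagGL_apply]))
      (h3.trans (by simp [swapGL_mul_diagGL_apply]))
      (h4.trans (by simp [swapGL_mul_diagGL_apply]))
      (h2.trans (by simp [swapGL_mul_diagGL_apply]))))))
  · exact Or.inr (Or.inl (Or.inr (hext _ h1 h3 h4 h2)))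

end FiniteOrder

/-! ### Classification of centralizers in `PGL(2, ℤ)` -/

section Classification

open Matrix

theorem swapGL_mul_swapGL : swapGL * swapGL = 1 := Units.ext swapGL.mul_inv

theorem diagGL_mul_diagGL : diagGL * diagGL = 1 := Units.ext diagGL.mul_inv

theorem swapGL_mul_diagGL : swapGL * diagGL = -(diagGL * swapGL) := by
  apply GL_two_ext <;>
    simp [GL_two_neg_apply, GL_two_mul_apply, swapGL_apply, diagGL_apply]

/-- `swapGL` and `diagGL` anticommute, so their classes commute and generate a Klein four-group,
which is the centralizer of each of its three involutions. As the traces vanish, lifts that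
anticommute with `M` count too. -/
theorem hasCentralizerType_involution {M : GL (Fin 2) ℤ}
    (hM : M = swapGL ∨ M = diagGL ∨ M = swapGL * diagGL) :
    HasCentralizerType (ProjGenLinGroup.mk M) := by
  set x : ProjGenLinGroup (Fin 2) ℤ := ProjGenLinGroup.mk swapGL with hx
  set y : ProjGenLinGroup (Fin 2) ℤ := ProjGenLinGroup.mk diagGL with hy
  have hxx : x * x = 1 := by rw [hx, ← map_mul, swapGL_mul_swapGL, map_one]
  have hyy : y * y = 1 := by rw [hy, ← map_mul, diagGL_mul_diagGL, map_one]
  have hxy : x * y = y * x := by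
    rw [hx, hy, ← map_mul, ← map_mul, swapGL_mul_diagGL, mk_neg]
  have hx1 : x ≠ 1 := by
    rw [hx, Ne, mk_eq_one_iff, GL_two_eq_one_iff, GL_two_eq_neg_one_iff]
    simp [swapGL_apply]
  have hy1 : y ≠ 1 := by
    rw [hy, Ne, mk_eq_one_iff, GL_two_eq_one_iff, GL_two_eq_neg_one_iff]
    simp [diagGL_apply]
  have hne : x ≠ y := by
    intro h
    rcases ProjGenLinGroup.mk_eq_mk_iff_eq_or_eq_neg.1 h with h | h
    · have : swapGL 0 0 = diagGL 0 0 := by rw [h]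
      simp [swapGL_apply, diagGL_apply] at this
    · have : swapGL 0 0 = (-diagGL) 0 0 := by rw [h]
      simp [GL_two_neg_apply, swapGL_apply, diagGL_apply] at this
  have hM' : ProjGenLinGroup.mk M = x ∨ ProjGenLinGroup.mk M = y ∨
      ProjGenLinGroup.mk M = x * y := by
    rw [hx, hy, ← map_mul]
    exact hM.imp (congrArg _) (Or.imp (congrArg _) (congrArg _))
  have hH : ∀ h ∈ Subgroup.centralizer {(ProjGenLinGroup.mk M : ProjGenLinGroup (Fin 2) ℤ)},
      h = 1 ∨ h = x ∨ h = y ∨ h = x * y := by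
    intro h hh
    obtain ⟨N, rfl⟩ := ProjGenLinGroup.mk_surjective h
    have hc := Subgroup.mem_centralizer_singleton_iff.1 hh
    rw [← map_mul, ← map_mul, ProjGenLinGroup.mk_eq_mk_iff_eq_or_eq_neg] at hc
    rw [mk_eq_one_iff, hx, hy, ← map_mul, ProjGenLinGroup.mk_eq_mk_iff_eq_or_eq_neg,
      ProjGenLinGroup.mk_eq_mk_iff_eq_or_eq_neg, ProjGenLinGroup.mk_eq_mk_iff_eq_or_eq_neg]
    exact signed_permutation_of_commute hM hc
  have hcx : x * ProjGenLinGroup.mk M = ProjGenLinGroup.mk M * x := by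
    rcases hM' with h | h | h <;> rw [h]
    · exact hxy
    · rw [mul_assoc, ← hxy]
  have hcy : y * ProjGenLinGroup.mk M = ProjGenLinGroup.mk M * y := by
    rcases hM' with h | h | h <;> rw [h]
    · exact hxy.symm
    · rw [← mul_assoc, ← hxy]
  refine Or.inr (Or.inl ⟨⟨?_, ?_⟩, nonempty_mulEquiv_kleinFour
    (Subgroup.mem_centralizer_singleton_iff.2 hcx) (Subgroup.mem_centralizer_singleton_iff.2 hcy)
    hxx hyy hxy hx1 hy1 hne hH⟩)
  · rw [sq]
    rcases hM' with h | h | h <;> rw [h]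
    · exact hxx
    · exact hyy
    · rw [mul_assoc, ← mul_assoc y, ← hxy, mul_assoc, hyy, mul_one, hxx]
  · rcases hM' with h | h | h <;> rw [h]
    · exact hx1
    · exact hy1
    · intro h
      exact hne (mul_right_cancel (h.trans hyy.symm))

theorem HasCentralizerType.of_isConj_GL {M N : GL (Fin 2) ℤ}
    (hN : HasCentralizerType (ProjGenLinGroup.mk N : ProjGenLinGroup (Fin 2) ℤ))
    (h : IsConj N M) : HasCentralizerType (ProjGenLinGroup.mk M : ProjGenLinGroup (Fin 2) ℤ) :=
  hN.of_isConj (MonoidHom.map_isConj ProjGenLinGroup.mk h)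

theorem hasCentralizerType_upper_reflection {M : GL (Fin 2) ℤ} (h10 : M 1 0 = 0)
    (h00 : M 0 0 = 1) (h11 : M 1 1 = -1) : HasCentralizerType (ProjGenLinGroup.mk M) := by
  -- A shear by `k` changes the corner by `-2 * k`, so only its parity matters: even gives `diagGL`,
  -- odd is conjugate to `swapGL`.
  have hconj := isConj_conj (shear (M 0 1 / 2)) M
  obtain ⟨e00, e01, e10, e11⟩ := shear_conj_apply (M 0 1 / 2) M
  refine HasCentralizerType.of_isConj_GL ?_ hconj.symm
  generalize shear (M 0 1 / 2) * M * (shear (M 0 1 / 2))⁻¹ = N at *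
  rw [h10, h00] at e00
  rw [h00, h10, h11] at e01
  rw [h10] at e10
  rw [h10, h11] at e11
  have h01 : N 0 1 = 0 ∨ N 0 1 = 1 := by omega
  rcases h01 with h01 | h01
  · refine hasCentralizerType_involution (Or.inr (Or.inl (GL_two_ext ?_ ?_ ?_ ?_))) <;>
      simp [diagGL_apply, e00, h01, e10, e11]
  · obtain ⟨f00, f01, f10, f11⟩ := swap_conj_apply N
    refine HasCentralizerType.of_isConj_GL ?_ (isConj_conj swapGL N).symm
    generalize swapGL * N * swapGL⁻¹ = P at *
    obtain ⟨g00, g01, g10, g11⟩ := shear_conj_apply 1 P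
    refine HasCentralizerType.of_isConj_GL ?_ (isConj_conj (shear 1) P).symm
    refine hasCentralizerType_involution (Or.inl (GL_two_ext ?_ ?_ ?_ ?_)) <;>
      simp [swapGL_apply, g00, g01, g10, g11, f00, f01, f10, f11, e00, h01, e10, e11]

/-- A finite search for lower left entry `1`: the discriminant bounds `b`, then the determinant
bounds `e`. The outcomes are involutions, transposed parabolics and order three. -/
theorem reduced_entries {a b e : ℤ} (hδ : |a - e| ≤ 1) (hdisc : |(a - e) ^ 2 + 4 * b| ≤ 4)
    (hdet : a * e - b = 1 ∨ a * e - b = -1) :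
    (a = 0 ∧ e = 0 ∧ (b = 1 ∨ b = -1)) ∨ (b = 0 ∧ a = e) ∨
      (b = -1 ∧ a * e = 0 ∧ (a + e = 1 ∨ a + e = -1)) := by
  obtain ⟨h1, h2⟩ := abs_le.1 hδ
  obtain ⟨h3, h4⟩ := abs_le.1 hdisc
  have hb : -2 < b ∧ b < 2 := by constructor <;> nlinarith
  have he : e ^ 2 < 3 ^ 2 := by
    rcases (show a = e ∨ a = e + 1 ∨ a = e - 1 by omega) with rfl | rfl | rfl <;>
      rcases hdet with h | h <;> nlinarith
  obtain ⟨he1, he2⟩ := abs_lt.1 (abs_lt_of_sq_lt_sq he (by norm_num))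
  obtain ⟨hb1, hb2⟩ := hb
  rcases (show a = e ∨ a = e + 1 ∨ a = e - 1 by omega) with rfl | rfl | rfl
  · interval_cases a <;> interval_cases b <;> simp_all
  all_goals interval_cases e <;> interval_cases b <;> simp_all

theorem hasCentralizerType_reduced {N : GL (Fin 2) ℤ}
    (hN : N 1 0 = 0 ∨ (N 1 0 = 1 ∧ |N 0 0 - N 1 1| ≤ 1))
    (hdisc : |(N 0 0 - N 1 1) ^ 2 + 4 * N 0 1 * N 1 0| ≤ 4) :
    HasCentralizerType (ProjGenLinGroup.mk N) := by
  have hdet := GL_two_det N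
  rcases hN with h10 | ⟨h10, hδ⟩
  · rw [h10, mul_zero, sub_zero] at hdet
    rcases hdet with hdet | hdet
    · have heq : N 0 0 = N 1 1 := by
        rcases Int.mul_eq_one_iff_eq_one_or_neg_one.1 hdet with h | h <;> omega
      by_cases h01 : N 0 1 = 0
      · left
        rw [mk_eq_one_iff, GL_two_eq_one_iff, GL_two_eq_neg_one_iff]
        rcases Int.mul_eq_one_iff_eq_one_or_neg_one.1 hdet with h | h <;> omega
      · exact hasCentralizerType_parabolic h10 h01 heq
    · rcases Int.mul_eq_neg_one_iff_eq_one_or_neg_one.1 hdet with ⟨h00, h11⟩ | ⟨h00, h11⟩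
      · exact hasCentralizerType_upper_reflection h10 h00 h11
      · rw [← mk_neg]
        refine hasCentralizerType_upper_reflection ?_ ?_ ?_ <;> rw [GL_two_neg_apply] <;> omega
  · rw [h10, mul_one] at hdet hdisc
    rcases reduced_entries hδ hdisc hdet with ⟨h00, h11, h01 | h01⟩ | ⟨h01, heq⟩ |
      ⟨h01, hprod, hsum⟩
    · exact hasCentralizerType_involution (Or.inl (GL_two_ext h00 h01 h10 h11))
    · refine hasCentralizerType_involution (Or.inr (Or.inr (GL_two_ext ?_ ?_ ?_ ?_))) <;>
        simp [swapGL_mul_diagGL_apply, h00, h01, h10, h11]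
    · obtain ⟨f00, f01, f10, f11⟩ := swap_conj_apply N
      refine HasCentralizerType.of_isConj_GL ?_ (isConj_conj swapGL N).symm
      exact hasCentralizerType_parabolic (by rw [f10, h01]) (by rw [f01, h10]; exact one_ne_zero)
        (by rw [f00, f11, heq])
    · exact hasCentralizerType_order_three h10 h01 hprod hsum

/-- The classification of centralizers in `PGL(2, ℤ)`. -/
theorem hasCentralizerType_PGL (g : ProjGenLinGroup (Fin 2) ℤ) : HasCentralizerType g := by
  obtain ⟨M, rfl⟩ := ProjGenLinGroup.mk_surjective g
  have hdisc : (M 0 0 - M 1 1) ^ 2 + 4 * M 0 1 * M 1 0 =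
      (M 0 0 + M 1 1) ^ 2 - 4 * (M 0 0 * M 1 1 - M 0 1 * M 1 0) := by ring
  rcases le_or_gt |(M 0 0 - M 1 1) ^ 2 + 4 * M 0 1 * M 1 0| 4 with hle | hgt
  · obtain ⟨N, hconj, hN, -, hd⟩ := exists_isConj_reduced M hle
    refine HasCentralizerType.of_isConj_GL ?_ hconj
    rw [← hd] at hle
    rcases hN with h10 | ⟨h10, hδ⟩
    · exact hasCentralizerType_reduced (Or.inl h10) hle
    · rcases (abs_eq one_pos.le).1 h10 with h10 | h10
      · exact hasCentralizerType_reduced (Or.inr ⟨h10, hδ⟩) hle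
      · rw [← mk_neg]
        refine hasCentralizerType_reduced (Or.inr ⟨by rw [GL_two_neg_apply, h10, neg_neg], ?_⟩) ?_
        · rw [GL_two_neg_apply, GL_two_neg_apply, neg_sub_neg, abs_sub_comm]
          exact hδ
        · simp only [GL_two_neg_apply]
          have heq : (-N 0 0 - -N 1 1) ^ 2 + 4 * -N 0 1 * -N 1 0 =
              (N 0 0 - N 1 1) ^ 2 + 4 * N 0 1 * N 1 0 := by ring
          rwa [heq]
  -- Since `D = t² ∓ 4 ≥ -4`, a discriminant with `|D| > 4` is positive; trace zero would give `D =
  -- ±4`.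
  · have hdet := GL_two_det M
    have ht : M 0 0 + M 1 1 ≠ 0 := by
      intro h
      rw [hdisc, h] at hgt
      rcases hdet with h | h <;> rw [h] at hgt <;> norm_num at hgt
    have hpos : 4 < (M 0 0 - M 1 1) ^ 2 + 4 * M 0 1 * M 1 0 := by
      rcases lt_abs.1 hgt with h | h
      · exact h
      · have := sq_nonneg (M 0 0 + M 1 1)
        omega
    refine hasCentralizerType_hyperbolic ht (by omega) ?_
    rw [hdisc] at hpos ⊢
    rcases hdet with h | h <;> rw [h] at hpos ⊢
    · refine not_isSquare_sq_sub_four ?_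
      by_contra hcon
      have h2 : |M 0 0 + M 1 1| ≤ 2 := by omega
      have := abs_nonneg (M 0 0 + M 1 1)
      rw [← sq_abs] at hpos
      nlinarith
    · exact not_isSquare_sq_add_four ht

end Classification

/-! ### Symmetry groups as centralizers -/

section SymmetryGroups

open Matrix

theorem nonempty_symmetryGroup_mulEquiv {Γ : Type*} [Group Γ] (e : nielsenTraceMaps ≃* Γ)
    (F : nielsenTraceMaps) :
    Nonempty (symmetryGroup F ≃* Subgroup.centralizer {e F}) := by
  have hmem : ∀ S, S ∈ symmetryGroup F ↔ e S ∈ Subgroup.centralizer {e F} := by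
    intro S
    rw [Subgroup.mem_centralizer_singleton_iff, ← map_mul, ← map_mul, e.injective.eq_iff]
    exact ⟨fun h => h.2, fun h => ⟨isUnit_nielsenTraceMaps S, h⟩⟩
  refine ⟨{ toFun := fun S => ⟨e S, (hmem S).1 S.2⟩
            invFun := fun g => ⟨e.symm g, (hmem _).2 (by rw [e.apply_symm_apply]; exact g.2)⟩
            left_inv := fun S => Subtype.ext (e.symm_apply_apply _)
            right_inv := fun g => Subtype.ext (e.apply_symm_apply _)
            map_mul' := fun S T => Subtype.ext (map_mul e _ _) }⟩

theorem not_mul_comm_PGL : ∃ x y : ProjGenLinGroup (Fin 2) ℤ, x * y ≠ y * x := by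
  refine ⟨ProjGenLinGroup.mk swapGL, ProjGenLinGroup.mk (shear 1), ?_⟩
  rw [← map_mul, ← map_mul, Ne, ProjGenLinGroup.mk_eq_mk_iff_eq_or_eq_neg]
  rintro (h | h)
  · have : (swapGL * shear 1) 0 0 = (shear 1 * swapGL) 0 0 := by rw [h]
    simp [GL_two_mul_apply, swapGL_apply, shear_apply] at this
  · have : (swapGL * shear 1) 0 1 = (-(shear 1 * swapGL)) 0 1 := by rw [h]
    simp [GL_two_neg_apply, GL_two_mul_apply, swapGL_apply, shear_apply] at this

/-- A symmetry group isomorphic to a commutative group is proper. -/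
theorem symmetryGroup_ne_top {A : Type*} [CommGroup A] {F : nielsenTraceMaps}
    (e : symmetryGroup F ≃* A) : symmetryGroup F ≠ ⊤ := by
  intro h
  obtain ⟨x, y, hxy⟩ := not_mul_comm_PGL
  apply hxy
  obtain ⟨S, rfl⟩ := nielsenTraceMapsEquiv.surjective x
  obtain ⟨T, rfl⟩ := nielsenTraceMapsEquiv.surjective y
  have hS : S ∈ symmetryGroup F := h ▸ Submonoid.mem_top S
  have hT : T ∈ symmetryGroup F := h ▸ Submonoid.mem_top T
  have : (⟨S, hS⟩ * ⟨T, hT⟩ : symmetryGroup F) = ⟨T, hT⟩ * ⟨S, hS⟩ := by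
    apply e.injective
    rw [map_mul, map_mul, mul_comm]
  rw [← map_mul, ← map_mul]
  exact congrArg nielsenTraceMapsEquiv (congrArg Subtype.val this)

theorem symmetryGroup_one : symmetryGroup 1 = ⊤ :=
  eq_top_iff.2 fun S _ => ⟨isUnit_nielsenTraceMaps S, by rw [mul_one, one_mul]⟩

end SymmetryGroups

theorem theorem1 :
    Nonempty (nielsenTraceMaps ≃* Matrix.ProjGenLinGroup (Fin 2) ℤ) ∧
    ∀ F : nielsenTraceMaps,
      (symmetryGroup F = ⊤ ↔ F = 1) ∧
      (Nonempty (symmetryGroup F ≃* Multiplicative (ZMod 2) × Multiplicative (ZMod 2)) ↔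
        F ^ 2 = 1 ∧ F ≠ 1) ∧
      (Nonempty (symmetryGroup F ≃* Multiplicative (ZMod 3)) ↔ F ^ 3 = 1 ∧ F ≠ 1) ∧
      (Nonempty (symmetryGroup F ≃* Multiplicative ℤ) ↔ ¬ IsOfFinOrder F) ∧
      (F = 1 ∨ (F ^ 2 = 1 ∧ F ≠ 1) ∨ (F ^ 3 = 1 ∧ F ≠ 1) ∨ ¬ IsOfFinOrder F) := by
  refine ⟨⟨nielsenTraceMapsEquiv⟩, fun F => ?_⟩
  obtain ⟨c⟩ := nonempty_symmetryGroup_mulEquiv nielsenTraceMapsEquiv F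
  have h1 : nielsenTraceMapsEquiv F = 1 ↔ F = 1 :=
    map_eq_one_iff nielsenTraceMapsEquiv nielsenTraceMapsEquiv.injective
  have hp : ∀ n : ℕ, nielsenTraceMapsEquiv F ^ n = 1 ↔ F ^ n = 1 := fun n => by
    rw [← map_pow, map_eq_one_iff _ nielsenTraceMapsEquiv.injective]
  have hf : IsOfFinOrder (nielsenTraceMapsEquiv F) ↔ IsOfFinOrder F :=
    Function.Injective.isOfFinOrder_iff
      (f := (nielsenTraceMapsEquiv : nielsenTraceMaps →* Matrix.ProjGenLinGroup (Fin 2) ℤ))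
      nielsenTraceMapsEquiv.injective
  -- The classification gives one direction of each equivalence. The converses follow because the
  -- four kinds of group are told apart by commutativity and cardinality.
  have htype := hasCentralizerType_PGL (nielsenTraceMapsEquiv F)
  rw [HasCentralizerType, Ne, h1, hp, hp, hf] at htype
  have fin2 : F ^ 2 = 1 → IsOfFinOrder F := fun h => isOfFinOrder_iff_pow_eq_one.2 ⟨2, by simp, h⟩
  have fin3 : F ^ 3 = 1 → IsOfFinOrder F := fun h => isOfFinOrder_iff_pow_eq_one.2 ⟨3, by simp, h⟩
  have h23 : F ^ 2 = 1 → F ^ 3 = 1 → F = 1 := fun h2 h3 => by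
    rwa [pow_succ, h2, one_mul] at h3
  have cardK : Nat.card (Multiplicative (ZMod 2) × Multiplicative (ZMod 2)) = 4 := by
    simp
  have card3 : Nat.card (Multiplicative (ZMod 3)) = 3 := by simp
  -- `Nat.card` of an infinite type is `0`, which still differs from `4` and `3`.
  have cardZ : Nat.card (Multiplicative ℤ) = 0 := by simp
  rcases htype with rfl | ⟨hF, ⟨e⟩⟩ | ⟨hF, ⟨e⟩⟩ | ⟨hF, ⟨e⟩⟩
  · have hcomm : ∀ {A : Type} [CommGroup A], ¬ Nonempty (symmetryGroup 1 ≃* A) :=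
      fun ⟨e⟩ => symmetryGroup_ne_top e symmetryGroup_one
    refine ⟨⟨fun _ => rfl, fun _ => symmetryGroup_one⟩, ⟨fun h => absurd h hcomm, fun h =>
      absurd rfl h.2⟩, ⟨fun h => absurd h hcomm, fun h => absurd rfl h.2⟩,
      ⟨fun h => absurd h hcomm, fun h => absurd IsOfFinOrder.one h⟩, Or.inl rfl⟩
  · replace e := c.trans e
    have hcard := Nat.card_congr e.toEquiv
    rw [cardK] at hcard
    refine ⟨⟨fun h => absurd h (symmetryGroup_ne_top e), fun h => absurd h hF.2⟩,
      ⟨fun _ => hF, fun _ => ⟨e⟩⟩, ⟨fun ⟨f⟩ => ?_, fun h => absurd (h23 hF.1 h.1) h.2⟩,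
      ⟨fun ⟨f⟩ => ?_, fun h => absurd (fin2 hF.1) h⟩, Or.inr (Or.inl hF)⟩
    · have := Nat.card_congr f.toEquiv
      omega
    · have := Nat.card_congr f.toEquiv
      omega
  · replace e := c.trans e
    have hcard := Nat.card_congr e.toEquiv
    rw [card3] at hcard
    refine ⟨⟨fun h => absurd h (symmetryGroup_ne_top e), fun h => absurd h hF.2⟩,
      ⟨fun ⟨f⟩ => ?_, fun h => absurd (h23 h.1 hF.1) h.2⟩, ⟨fun _ => hF, fun _ => ⟨e⟩⟩,
      ⟨fun ⟨f⟩ => ?_, fun h => absurd (fin3 hF.1) h⟩, Or.inr (Or.inr (Or.inl hF))⟩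
    · have := Nat.card_congr f.toEquiv
      omega
    · have := Nat.card_congr f.toEquiv
      omega
  · replace e := c.trans e
    have hcard := Nat.card_congr e.toEquiv
    rw [cardZ] at hcard
    refine ⟨⟨fun h => absurd h (symmetryGroup_ne_top e), ?_⟩,
      ⟨fun ⟨f⟩ => ?_, fun h => absurd (fin2 h.1) hF⟩,
      ⟨fun ⟨f⟩ => ?_, fun h => absurd (fin3 h.1) hF⟩,
      ⟨fun _ => hF, fun _ => ⟨e⟩⟩, Or.inr (Or.inr (Or.inr hF))⟩
    · rintro rfl
      exact absurd IsOfFinOrder.one hF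
    · have := Nat.card_congr f.toEquiv
      omega
    · have := Nat.card_congr f.toEquiv
      omega
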